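/- Let $p$ be a prime, let $K$ be a $p$-adic number field (a finite extension of $\mathbb{Q}_p$) with ring of integers $\mathcal{O}_K$, and fix an algebraic closure $\overline{\mathbb{Q}}_p$ of $\mathbb{Q}_p$ with its $p$-adic topology. Let $\mathcal{O}$ be an integral domain and a $\mathbb{Z}_p$-algebra, and let $S\subseteq\mathcal{O}$ be a countable set of nonzero elements. (1) Suppose that for some $m\ge 0$ there is an injective $\mathbb{Z}_p$-algebra homomorphism $\mathcal{O}_K[[X_1,\dots,X_m]]\to\mathcal{O}$ which makes $\mathcal{O}$ a finite module over $\mathcal{O}_K[[X_1,\dots,X_m]]$. Then $\mathcal{O}$ is a local ring, and there is a $\mathbb{Z}_p$-algebra homomorphism $\lambda:\mathcal{O}\to\overline{\mathbb{Q}}_p$, continuous for the maximal ideal adic topology on $\mathcal{O}$, such that $\lambda(s)\ne 0$ for every $s\in S$. (2) Suppose that $\mathcal{O}$ is an affinoid algebra over $K$, i.e. (compatibly with its $\mathbb{Z}_p$-algebra structure) a $K$-algebra isomorphic to a quotient of a Tate algebra $K\langle X_1,\dots,X_n\rangle$, the algebra of formal power series over $K$ whose coefficients tend to $0$. Then there is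 a $\mathbb{Z}_p$-algebra homomorphism $\lambda:\mathcal{O}\to\overline{\mathbb{Q}}_p$, continuous for the Banach algebra topology on $\mathcal{O}$ (the quotient topology of the Gauss norm topology under any surjective $K$-algebra homomorphism $K\langle X_1,\dots,X_n\rangle\to\mathcal{O}$), such that $\lambda(s)\ne 0$ for every $s\in S$. -/

import Mathlib

namespace TateDefs

noncomputable section

/-- The Tate algebra `K⟨X₁, …, Xₙ⟩` over a nonarchimedean field `K`: the formal power series
whose coefficients tend to zero. -/
def TateAlgebra (K : Type*) [NormedField K] [IsUltrametricDist K] (n : ℕ) :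
    Subalgebra K (MvPowerSeries (Fin n) K) where
  __ := MvPowerSeries.IsRestricted.subring (R := K) (fun _ : Fin n => (1 : ℝ))
  algebraMap_mem' a := MvPowerSeries.isRestricted_C (fun _ : Fin n => (1 : ℝ)) a

variable {K : Type*} [NormedField K] [IsUltrametricDist K] {n : ℕ}

theorem isRestricted_of_mem (f : TateAlgebra K n) :
    MvPowerSeries.IsRestricted (fun _ => (1 : ℝ)) (f : MvPowerSeries (Fin n) K) :=
  f.2

/-- Membership in the Tate algebra: the coefficients tend to zero. -/
theorem mem_tateAlgebra_iff (f : MvPowerSeries (Fin n) K) :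
    f ∈ TateAlgebra K n ↔
      Filter.Tendsto (fun t => ‖MvPowerSeries.coeff t f‖) Filter.cofinite (nhds 0) := by
  have h : f ∈ TateAlgebra K n ↔ MvPowerSeries.IsRestricted (fun _ => (1 : ℝ)) f := Iff.rfl
  rw [h]
  simp [MvPowerSeries.IsRestricted, Finsupp.prod]

theorem hasGaussNorm (f : TateAlgebra K n) :
    MvPowerSeries.HasGaussNorm (fun a : K => ‖a‖) (fun _ => (1 : ℝ))
      (f : MvPowerSeries (Fin n) K) := by
  have h := isRestricted_of_mem f
  rw [MvPowerSeries.IsRestricted] at h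
  exact h.bddAbove_range_of_cofinite

/-- The Gauss norm `‖∑ aₜ Xᵗ‖ = sup ‖aₜ‖` on the Tate algebra. -/
def gaussRingNorm (K : Type*) [NormedField K] [IsUltrametricDist K] (n : ℕ) :
    RingNorm (TateAlgebra K n) where
  toFun f := MvPowerSeries.gaussNorm (fun a : K => ‖a‖) (fun _ => (1 : ℝ))
    (f : MvPowerSeries (Fin n) K)
  map_zero' := MvPowerSeries.gaussNorm_zero _ _ norm_zero
  add_le' f g := (MvPowerSeries.gaussNorm_add_le_max _ _ _ _ (fun _ => zero_le_one)
    (fun a => norm_nonneg a) (fun a b => IsUltrametricDist.norm_add_le_max a b)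
    (hasGaussNorm f) (hasGaussNorm g)).trans
      (max_le_add_of_nonneg (MvPowerSeries.gaussNorm_nonneg _ _ _ fun a => norm_nonneg a)
        (MvPowerSeries.gaussNorm_nonneg _ _ _ fun a => norm_nonneg a))
  neg' _ := MvPowerSeries.gaussNorm_neg _ _ (fun a => norm_neg a) _
  mul_le' f g := MvPowerSeries.gaussNorm_mul_le _ _ _ _ (fun _ => zero_le_one)
    (fun a => norm_nonneg a) (fun a b => (norm_mul a b).le)
    (fun a b => IsUltrametricDist.norm_add_le_max a b) norm_zero
    (hasGaussNorm f) (hasGaussNorm g)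
  eq_zero_of_map_eq_zero' f hf := Subtype.ext ((MvPowerSeries.gaussNorm_eq_zero_iff _ _ _
    norm_zero (fun a => norm_nonneg a) (fun _ h => norm_eq_zero.mp h)
    (fun _ => zero_lt_one) (hasGaussNorm f)).mp hf)

/-- The Tate algebra with its Gauss norm. -/
instance instNormedRing (K : Type*) [NormedField K] [IsUltrametricDist K] (n : ℕ) :
    NormedRing (TateAlgebra K n) :=
  (gaussRingNorm K n).toNormedRing

/-- An affinoid `K`-algebra: a quotient of a Tate algebra over `K`. -/
def IsAffinoidAlgebra (K : Type*) [NormedField K] [IsUltrametricDist K]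
    (A : Type*) [CommRing A] [Algebra K A] : Prop :=
  ∃ (n : ℕ) (π : TateAlgebra K n →ₐ[K] A), Function.Surjective π

/-- The Banach algebra topology on an affinoid algebra `A` presented as a quotient
`π : K⟨X₁, …, Xₙ⟩ → A`: the quotient of the Gauss norm topology, i.e. the topology of the
residue norm of `π`. -/
abbrev residueTopology {A : Type*} [CommRing A] [Algebra K A] (π : TateAlgebra K n →ₐ[K] A) :
    TopologicalSpace A :=
  TopologicalSpace.coinduced π
    (instNormedRing K n).toMetricSpace.toUniformSpace.toTopologicalSpace

end

end TateDefs

/-! Both parts rest on one fact: countably many nonzero series in `m` variables over `ℤ_[p]` all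
stay nonzero under some homomorphism to `ℤ_[p]`. In one variable, Weierstrass preparation leaves
each series finitely many zeros in the maximal ideal of `ℤ_[p]`, which is uncountable; induction on
`m` does the rest. If a domain is integral over a subring `B` of such a series ring, every nonzero
`s` divides a nonzero `r` in `B`. It is then enough to keep each `r` nonzero and to extend the
homomorphism by lying over into the algebraically closed `PadicAlgCl p`
(`exists_algHom_padicAlgCl_ne_zero`).

In (1), `B` is the series ring over `ℤ_[p]`, since the integers of `K` are finite over `ℤ_[p]`. The
domain is local because Hensel's lemma lifts idempotents from an Artinian quotient. In (2), the
image `A` of the unit ball of the Tate algebra satisfies `O = A[1/p]`. It is `p`-complete,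
`p`-torsion-free and of finite type modulo `p`. Noether normalization over the residue field
therefore lifts, making `A` finite over the `p`-adic completion of a polynomial ring, which embeds
in the series ring.

Continuity is automatic. If `‖l f‖ ≥ 1`, then `(l f)⁻¹` is a root of a monic polynomial over
`ℤ_[p]`; reversing it gives `q` with `l (1 + f q(f)) = 0`, impossible when `1 + f q(f)` is a unit.
-/

/-! ### Evaluating power series away from countably many zero sets -/

namespace PadicInt

open IsLocalRing

variable (p : ℕ) [Fact p.Prime]

/-- A point of the maximal ideal defines an evaluation homomorphism on power series. -/
theorem exists_powerSeries_evaluation (u : ℤ_[p]) (hu : u ∈ maximalIdeal ℤ_[p]) :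
    ∃ e : PowerSeries ℤ_[p] →ₐ[ℤ_[p]] ℤ_[p], ∀ P : Polynomial ℤ_[p],
      e (P : PowerSeries ℤ_[p]) = P.eval u := by
  -- As `X - u` is distinguished, Weierstrass division identifies the quotients of the power series
  -- ring and of the polynomial ring by it; the latter is `ℤ_[p]` via evaluation at `u`.
  have H : (Polynomial.X - Polynomial.C u).IsDistinguishedAt (maximalIdeal ℤ_[p]) :=
    { monic := Polynomial.monic_X_sub_C u
      mem := by
        intro n hn
        rw [Polynomial.natDegree_X_sub_C, Nat.lt_one_iff] at hn
        subst hn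
        simpa using hu }
  refine ⟨((Polynomial.quotientSpanXSubCAlgEquiv u).toAlgHom.comp
    H.algEquivQuotient.symm.toAlgHom).comp (Ideal.Quotient.mkₐ ℤ_[p] _), fun P => ?_⟩
  have h : (Ideal.Quotient.mk (Ideal.span {((Polynomial.X - Polynomial.C u : Polynomial ℤ_[p]) :
      PowerSeries ℤ_[p])}) (P : PowerSeries ℤ_[p])) =
      H.algEquivQuotient (Ideal.Quotient.mk _ P) := by
    simp
  change Polynomial.quotientSpanXSubCAlgEquiv u (H.algEquivQuotient.symm
    (Ideal.Quotient.mk _ (P : PowerSeries ℤ_[p]))) = _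
  rw [h, AlgEquiv.symm_apply_apply]
  simp

/-- A nonzero power series over `ℤ_[p]` is a power of `p` times a polynomial times a unit. -/
theorem exists_eq_pow_mul_polynomial_mul_unit (f : PowerSeries ℤ_[p]) (hf : f ≠ 0) :
    ∃ (v : ℕ) (P : Polynomial ℤ_[p]) (h : PowerSeries ℤ_[p]), P ≠ 0 ∧ IsUnit h ∧
      f = (p : PowerSeries ℤ_[p]) ^ v * (P * h) := by
  have hfin : FiniteMultiplicity (p : PowerSeries ℤ_[p]) f := by
    obtain ⟨n, hn⟩ : ∃ n, PowerSeries.coeff n f ≠ 0 := by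
      by_contra! h
      exact hf (PowerSeries.ext fun n => by simpa using h n)
    have h1 : FiniteMultiplicity (p : ℤ_[p]) (PowerSeries.coeff n f) :=
      FiniteMultiplicity.of_prime_left PadicInt.prime_p hn
    obtain ⟨k, hk⟩ := h1
    refine ⟨k, fun hd => hk ?_⟩
    obtain ⟨g, rfl⟩ := hd
    refine ⟨PowerSeries.coeff n g, ?_⟩
    have : (p : PowerSeries ℤ_[p]) ^ (k + 1) = PowerSeries.C ((p : ℤ_[p]) ^ (k + 1)) := by simp
    rw [this, PowerSeries.coeff_C_mul]
  obtain ⟨g, hg, hndvd⟩ := hfin.exists_eq_pow_mul_and_not_dvd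
  -- Once the full power of `p` is removed, some coefficient is a unit, which is what Weierstrass
  -- preparation requires.
  have hres : g.map (residue ℤ_[p]) ≠ 0 := by
    intro h0
    refine hndvd ?_
    have : ∀ n, ∃ c, PowerSeries.coeff n g = p * c := by
      intro n
      have h1 := congrArg (PowerSeries.coeff n) h0
      rw [PowerSeries.coeff_map, map_zero, residue_eq_zero_iff,
        PadicInt.maximalIdeal_eq_span_p, Ideal.mem_span_singleton] at h1
      exact h1
    choose c hc using this
    refine ⟨PowerSeries.mk c, PowerSeries.ext fun n => ?_⟩
    have : (p : PowerSeries ℤ_[p]) = PowerSeries.C (p : ℤ_[p]) := by simp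
    rw [this, PowerSeries.coeff_C_mul, hc, PowerSeries.coeff_mk]
  obtain ⟨P, h, H⟩ := PowerSeries.exists_isWeierstrassFactorization hres
  exact ⟨_, P, h, H.isDistinguishedAt.monic.ne_zero, H.isUnit, by rw [hg, ← H.eq_mul]⟩

theorem not_countable_maximalIdeal : ¬ ((maximalIdeal ℤ_[p] : Set ℤ_[p])).Countable := by
  intro h
  have hp : (p : ℤ_[p]) ≠ 0 := PadicInt.prime_p.ne_zero
  have h1 : Countable ℤ_[p] := by
    have : Countable (maximalIdeal ℤ_[p] : Set ℤ_[p]) := h.to_subtype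
    refine Function.Injective.countable (f := fun x : ℤ_[p] =>
      (⟨p * x, Ideal.mul_mem_right _ _ PadicInt.p_nonunit⟩ :
        (maximalIdeal ℤ_[p] : Set ℤ_[p]))) ?_
    intro x y hxy
    exact mul_left_cancel₀ hp (congrArg Subtype.val hxy)
  have h2 : Countable ℚ_[p] := by
    refine Function.Surjective.countable (f := fun x : ℤ_[p] × ℤ_[p] => (x.1 : ℚ_[p]) / x.2) ?_
    intro x
    obtain ⟨a, b, -, hab⟩ := IsFractionRing.div_surjective (A := ℤ_[p]) x
    exact ⟨(a, b), hab⟩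
  have h3 := continuum_le_cardinal_of_nontriviallyNormedField ℚ_[p]
  exact absurd (Cardinal.mk_le_aleph0 (α := ℚ_[p])) (not_le.mpr (Cardinal.aleph0_lt_continuum.trans_le h3))

/-- Up to a power of `p` and a unit each series is a nonzero polynomial, so the points to avoid form
a countable union of finite sets. -/
theorem exists_powerSeries_algHom_ne_zero (S : Set (PowerSeries ℤ_[p])) (hS : S.Countable)
    (hS0 : ∀ f ∈ S, f ≠ 0) :
    ∃ e : PowerSeries ℤ_[p] →ₐ[ℤ_[p]] ℤ_[p], ∀ f ∈ S, e f ≠ 0 := by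
  choose! v P h hP hh hf using fun f (hf : f ∈ S) =>
    exists_eq_pow_mul_polynomial_mul_unit p f (hS0 f hf)
  have hc : (⋃ f ∈ S, {u : ℤ_[p] | (P f).IsRoot u}).Countable :=
    hS.biUnion fun f hfS => (Polynomial.finite_setOfPred_isRoot (hP f hfS)).countable
  obtain ⟨u, hu, huS⟩ : ∃ u ∈ maximalIdeal ℤ_[p],
      u ∉ (⋃ f ∈ S, {u : ℤ_[p] | (P f).IsRoot u}) := by
    by_contra! hcon
    exact not_countable_maximalIdeal p (hc.mono hcon)
  obtain ⟨e, he⟩ := exists_powerSeries_evaluation p u hu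
  refine ⟨e, fun f hfS => ?_⟩
  rw [hf f hfS, map_mul, map_pow, map_natCast, map_mul, he]
  refine mul_ne_zero (pow_ne_zero _ PadicInt.prime_p.ne_zero) (mul_ne_zero ?_ ?_)
  · intro h0
    exact huS (Set.mem_biUnion hfS h0)
  · exact ((hh f hfS).map e).ne_zero

/-- Countably many nonzero power series in several variables over `ℤ_[p]` do not vanish
simultaneously under a suitable homomorphism to `ℤ_[p]`. -/
theorem exists_mvPowerSeries_algHom_ne_zero (m : ℕ) (S : Set (MvPowerSeries (Fin m) ℤ_[p]))
    (hS : S.Countable) (hS0 : ∀ f ∈ S, f ≠ 0) :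
    ∃ e : MvPowerSeries (Fin m) ℤ_[p] →ₐ[ℤ_[p]] ℤ_[p], ∀ f ∈ S, e f ≠ 0 := by
  induction m with
  | zero =>
    refine ⟨(MvPowerSeries.isEmptyEquiv (Fin 0) ℤ_[p]).toAlgHom, fun f hf => ?_⟩
    exact (map_ne_zero_iff _ (MvPowerSeries.isEmptyEquiv (Fin 0) ℤ_[p]).injective).mpr (hS0 f hf)
  | succ m ih =>
    let E := MvPowerSeries.finSuccEquiv ℤ_[p] m
    have hE : ∀ f ∈ S, ∃ n, PowerSeries.coeff n (E f) ≠ 0 := by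
      intro f hf
      by_contra! h
      exact hS0 f hf (E.injective (PowerSeries.ext fun n => by simpa using h n))
    -- One nonzero coefficient per series suffices: the inductive homomorphism `e₁` keeps it
    -- nonzero, and the one-variable case then applies to the series obtained by mapping
    -- coefficients.
    choose! n hn using hE
    obtain ⟨e₁, he₁⟩ := ih ((fun f => PowerSeries.coeff (n f) (E f)) '' S) (hS.image _) (by
      rintro _ ⟨f, hf, rfl⟩
      exact hn f hf)
    obtain ⟨e₂, he₂⟩ := exists_powerSeries_algHom_ne_zero p
      ((fun f => PowerSeries.map (e₁ : _ →+* _) (E f)) '' S) (hS.image _) (by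
      rintro _ ⟨f, hf, rfl⟩ h0
      refine he₁ _ ⟨f, hf, rfl⟩ ?_
      have := congrArg (PowerSeries.coeff (n f)) h0
      simpa using this)
    refine ⟨(e₂.comp (PowerSeries.mapAlgHom e₁)).comp E.toAlgHom, fun f hf => ?_⟩
    exact he₂ _ ⟨f, hf, rfl⟩

end PadicInt

/-! ### Extending homomorphisms along integral extensions -/

/-- A homomorphism to an algebraically closed field extends along an injective integral
extension. -/
theorem exists_ringHom_comp_algebraMap_eq {B A Ω : Type*} [CommRing B] [CommRing A] [Algebra B A]
    [Algebra.IsIntegral B A] [FaithfulSMul B A] [Field Ω] [IsAlgClosed Ω] (f : B →+* Ω) :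
    ∃ g : A →+* Ω, g.comp (algebraMap B A) = f := by
  have hP : (RingHom.ker f).IsPrime := RingHom.ker_isPrime f
  obtain ⟨Q, -, hQ, hQP⟩ := Ideal.exists_ideal_over_prime_of_isIntegral (RingHom.ker f)
    (⊥ : Ideal A) (by
      rw [show Ideal.comap (algebraMap B A) ⊥ = ⊥ from
        (RingHom.injective_iff_ker_eq_bot _).mp (FaithfulSMul.algebraMap_injective B A)]
      exact bot_le)
  have hlies : Q.LiesOver (RingHom.ker f) := ⟨hQP.symm⟩
  let f' : B ⧸ RingHom.ker f →+* Ω := RingHom.kerLift f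
  have hf' : Function.Injective f' := RingHom.kerLift_injective f
  let _ : Algebra (B ⧸ RingHom.ker f) Ω := f'.toAlgebra
  have : Module.IsTorsionFree (B ⧸ RingHom.ker f) Ω :=
    Module.isTorsionFree_iff_algebraMap_injective.mpr hf'
  have : Module.IsTorsionFree (B ⧸ RingHom.ker f) (A ⧸ Q) := by
    exact Module.isTorsionFree_iff_algebraMap_injective.mpr (FaithfulSMul.algebraMap_injective _ _)
  let g : A ⧸ Q →ₐ[B ⧸ RingHom.ker f] Ω := IsAlgClosed.lift
  refine ⟨(g : A ⧸ Q →+* Ω).comp (Ideal.Quotient.mk Q), RingHom.ext fun b => ?_⟩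
  exact g.commutes (Ideal.Quotient.mk _ b)

section Padic

variable (p : ℕ) [Fact p.Prime]

/-- A domain that is integral over a subring of a power series ring over `ℤ_[p]` has a
homomorphism to `PadicAlgCl p` which is nonzero at countably many given nonzero elements. -/
theorem exists_algHom_padicAlgCl_ne_zero {B A : Type*} [CommRing B] [CommRing A] [IsDomain A]
    [Algebra B A] [Algebra.IsIntegral B A] [FaithfulSMul B A] [Algebra ℤ_[p] B] [Algebra ℤ_[p] A]
    [IsScalarTower ℤ_[p] B A] {m : ℕ} (ι : B →ₐ[ℤ_[p]] MvPowerSeries (Fin m) ℤ_[p])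
    (hι : Function.Injective ι) (S : Set A) (hS : S.Countable) (hS0 : ∀ s ∈ S, s ≠ 0) :
    ∃ l : A →ₐ[ℤ_[p]] PadicAlgCl p, ∀ s ∈ S, l s ≠ 0 := by
  have hB : IsDomain B := (FaithfulSMul.algebraMap_injective B A).isDomain _
  -- In a domain, an algebraic relation for `s ≠ 0` can be taken with nonzero constant term, and `s`
  -- divides that term.
  have hdvd : ∀ s ∈ S, ∃ r : B, r ≠ 0 ∧ s ∣ algebraMap B A r := fun s hs =>
    (Algebra.IsIntegral.isIntegral (R := B) s).isAlgebraic.exists_nonzero_dvd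
      (mem_nonZeroDivisors_of_ne_zero (hS0 s hs))
  choose! r hr hsr using hdvd
  obtain ⟨e, he⟩ := PadicInt.exists_mvPowerSeries_algHom_ne_zero p m ((fun s => ι (r s)) '' S)
    (hS.image _) (by
      rintro _ ⟨s, hs, rfl⟩
      exact (map_ne_zero_iff _ hι).mpr (hr s hs))
  have hinj : Function.Injective (algebraMap ℤ_[p] (PadicAlgCl p)) := by
    rw [IsScalarTower.algebraMap_eq ℤ_[p] ℚ_[p] (PadicAlgCl p)]
    exact (algebraMap ℚ_[p] (PadicAlgCl p)).injective.comp
      (IsFractionRing.injective ℤ_[p] ℚ_[p])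
  obtain ⟨g, hg⟩ := exists_ringHom_comp_algebraMap_eq (A := A)
    ((algebraMap ℤ_[p] (PadicAlgCl p)).comp ((e.comp ι : B →ₐ[ℤ_[p]] ℤ_[p]) : B →+* ℤ_[p]))
  have hgB : ∀ b, g (algebraMap B A b) = algebraMap ℤ_[p] (PadicAlgCl p) (e (ι b)) :=
    fun b => RingHom.congr_fun hg b
  refine ⟨{ g with commutes' := fun c => ?_ }, fun s hs h0 => ?_⟩
  · change g (algebraMap ℤ_[p] A c) = _
    rw [IsScalarTower.algebraMap_apply ℤ_[p] B A, hgB]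
    simp
  · obtain ⟨z, hz⟩ := hsr s hs
    have h1 : g (algebraMap B A (r s)) = 0 := by
      rw [hz, map_mul]
      exact mul_eq_zero_of_left h0 _
    rw [hgB, map_eq_zero_iff _ hinj] at h1
    exact he _ ⟨s, hs, rfl⟩ h1

/-! ### Automatic norm bounds -/

/-- The norm on `PadicAlgCl p` is the spectral norm, so `‖x‖ ≤ 1` forces the minimal polynomial to
have coefficients in `ℤ_[p]`. -/
theorem PadicAlgCl.isIntegral_of_norm_le_one (x : PadicAlgCl p) (hx : ‖x‖ ≤ 1) :
    ∃ P : Polynomial ℤ_[p], P.Monic ∧ Polynomial.aeval x P = 0 := by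
  have hint : IsIntegral ℚ_[p] x := Algebra.IsIntegral.isIntegral x
  have hmon := minpoly.monic hint
  have h1 : ∀ n, ‖(minpoly ℚ_[p] x).coeff n‖ ≤ 1 := by
    rw [← spectralValue_le_one_iff hmon]
    exact hx
  have h2 : minpoly ℚ_[p] x ∈ Polynomial.lifts (algebraMap ℤ_[p] ℚ_[p]) := by
    rw [Polynomial.lifts_iff_coeff_lifts]
    exact fun n => ⟨⟨_, h1 n⟩, rfl⟩
  obtain ⟨P, hP, -, hPm⟩ := Polynomial.lifts_and_degree_eq_and_monic h2 hmon
  refine ⟨P, hPm, ?_⟩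
  have : Polynomial.aeval x (P.map (algebraMap ℤ_[p] ℚ_[p])) = 0 := by rw [hP, minpoly.aeval]
  rwa [Polynomial.aeval_map_algebraMap] at this

/-- Automatic contractivity: `‖l f‖ < 1` as soon as `1 + f q(f)` is a unit for all polynomials
`q` over `ℤ_[p]`. -/
theorem PadicAlgCl.norm_algHom_lt_one {A : Type*} [CommRing A] [Algebra ℤ_[p] A]
    (l : A →ₐ[ℤ_[p]] PadicAlgCl p) (f : A)
    (hf : ∀ q : Polynomial ℤ_[p], IsUnit (1 + f * Polynomial.aeval f q)) : ‖l f‖ < 1 := by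
  by_contra! hcon
  have hne : l f ≠ 0 := by
    intro h
    rw [h, norm_zero] at hcon
    linarith
  obtain ⟨P, hPm, hP⟩ := PadicAlgCl.isIntegral_of_norm_le_one p (l f)⁻¹ (by
    rw [norm_inv]
    exact inv_le_one_of_one_le₀ hcon)
  have h1 : Polynomial.aeval (l f) P.reverse = 0 := by
    let _ : Invertible (l f)⁻¹ := ⟨l f, mul_inv_cancel₀ hne, inv_mul_cancel₀ hne⟩
    exact (Polynomial.eval₂_reverse_eq_zero_iff (algebraMap ℤ_[p] (PadicAlgCl p)) (l f)⁻¹ P).mpr hP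
  have h2 : P.reverse = 1 + Polynomial.X * P.reverse.divX := by
    conv_lhs => rw [← Polynomial.X_mul_divX_add P.reverse]
    rw [Polynomial.coeff_zero_reverse, hPm.leadingCoeff, map_one, add_comm]
  have h3 : l (1 + f * Polynomial.aeval f P.reverse.divX) = 0 := by
    rw [← h1]
    conv_rhs => rw [h2]
    simp [Polynomial.aeval_algHom_apply]
  exact ((hf P.reverse.divX).map l).ne_zero h3

/-- If `‖l f‖ > 1`, some `p * f ^ k` has image of norm greater than one, contradicting the strict
bound for that element. -/
theorem PadicAlgCl.norm_algHom_le_one {A : Type*} [CommRing A] [Algebra ℤ_[p] A]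
    (l : A →ₐ[ℤ_[p]] PadicAlgCl p) (f : A)
    (hf : ∀ q : Polynomial ℤ_[p], IsUnit (1 + (p : A) * Polynomial.aeval f q)) : ‖l f‖ ≤ 1 := by
  by_contra! hcon
  have hp0 : ‖(p : PadicAlgCl p)‖ = (p : ℝ)⁻¹ := by
    rw [← map_natCast (algebraMap ℚ_[p] (PadicAlgCl p)), norm_algebraMap', Padic.norm_p]
  have hp1 : (0 : ℝ) < p := by exact_mod_cast (Fact.out : p.Prime).pos
  obtain ⟨k, hk⟩ := pow_unbounded_of_one_lt (p : ℝ) hcon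
  have := PadicAlgCl.norm_algHom_lt_one p l ((p : A) * f ^ k) (fun q => by
    convert hf (Polynomial.X ^ k * q.comp (Polynomial.C (p : ℤ_[p]) * Polynomial.X ^ k)) using 2
    simp [Polynomial.aeval_comp, mul_assoc])
  rw [map_mul, map_pow, map_natCast, norm_mul, norm_pow, hp0, inv_mul_lt_iff₀ hp1, mul_one] at this
  linarith

end Padic

/-! ### Complete local domains and continuity for the maximal ideal -/

section LocalRings

open IsLocalRing

/-- Compact Hausdorff Noetherian topological rings are precomplete for every ideal. -/
theorem IsPrecomplete.of_compactSpace {R : Type*} [CommRing R] [IsNoetherianRing R]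
    [TopologicalSpace R] [IsTopologicalRing R] [CompactSpace R] [T2Space R] (I : Ideal R) :
    IsPrecomplete I R where
  prec' f hf := by
    let S (n : ℕ) : Set R := {x | x - f n ∈ I ^ n}
    have hcl (n : ℕ) : IsClosed (S n) :=
      (IsNoetherianRing.isClosed_ideal (I ^ n)).preimage (continuous_id.sub continuous_const)
    -- The possible limits modulo `I ^ n` form nested nonempty compact sets, closed because ideals
    -- are; any point of the intersection is a limit.
    have hS (n : ℕ) : S (n + 1) ⊆ S n := by
      intro x hx
      have h1 := hf n.le_succ
      rw [smul_eq_mul, Ideal.mul_top, SModEq.sub_mem] at h1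
      have h2 := Ideal.pow_le_pow_right n.le_succ hx
      have := sub_mem h2 h1
      rwa [sub_sub_sub_cancel_right] at this
    obtain ⟨L, hL⟩ := (hcl 0).isCompact.nonempty_iInter_of_sequence_nonempty_isCompact_isClosed S hS
      (fun n => ⟨f n, by simp [S]⟩) hcl
    refine ⟨L, fun n => ?_⟩
    rw [smul_eq_mul, Ideal.mul_top]
    exact (SModEq.sub_mem.mpr (Set.mem_iInter.mp hL n)).symm

/-- For finite `M`, completion is a quotient of the completed ring tensored with `M`, and every
element of the completed ring comes from `R`. -/
theorem IsPrecomplete.of_finite {R M : Type*} [CommRing R] [AddCommGroup M] [Module R M]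
    [Module.Finite R M] (I : Ideal R) [IsPrecomplete I R] : IsPrecomplete I M := by
  rw [← AdicCompletion.of_surjective_iff]
  intro x
  obtain ⟨t, rfl⟩ := AdicCompletion.ofTensorProduct_surjective_of_finite I M x
  induction t with
  | zero => exact ⟨0, by simp⟩
  | tmul r y =>
    obtain ⟨r, rfl⟩ := AdicCompletion.of_surjective I R r
    refine ⟨r • y, ?_⟩
    rw [AdicCompletion.ofTensorProduct_tmul, map_smul]
    ext n
    simp [AdicCompletion.val_smul_apply]
    rfl
  | add a b ha hb =>
    obtain ⟨a', ha⟩ := ha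
    obtain ⟨b', hb⟩ := hb
    exact ⟨a' + b', by rw [map_add, map_add, ha, hb]⟩

/-- A domain that is Henselian along an ideal `J` has only trivial idempotents modulo `J`. -/
theorem HenselianRing.mem_or_sub_one_mem {O : Type*} [CommRing O] [IsDomain O] (J : Ideal O)
    [HenselianRing O J] (e : O) (he : e * e - e ∈ J) : e ∈ J ∨ e - 1 ∈ J := by
  have hder : Polynomial.eval e (Polynomial.derivative (Polynomial.X ^ 2 - Polynomial.X)) =
      2 * e - 1 := by simp [one_add_one_eq_two]
  have hmon : (Polynomial.X ^ 2 - Polynomial.X : Polynomial O).Monic := by monicity!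
  obtain ⟨a, ha, hae⟩ := HenselianRing.is_henselian (I := J)
    (Polynomial.X ^ 2 - Polynomial.X : Polynomial O) hmon e
    (by simpa [pow_two] using he)
    -- Hensel's derivative condition holds since `(2e - 1)² = 1 + 4(e² - e)`, which is `1` modulo
    -- `J`.
    (by
      rw [hder]
      refine IsUnit.of_mul_eq_one (Ideal.Quotient.mk J (2 * e - 1)) ?_
      rw [← map_mul, ← map_one (Ideal.Quotient.mk J), Ideal.Quotient.eq]
      convert J.mul_mem_left 4 he using 1
      ring)
  have ha' : a * (a - 1) = 0 := by
    have : a ^ 2 - a = 0 := by simpa [Polynomial.IsRoot] using ha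
    linear_combination this
  rcases mul_eq_zero.mp ha' with h0 | h0
  · left
    simpa [h0] using hae
  · right
    rw [sub_eq_zero.mp h0] at hae
    simpa using J.neg_mem hae

/-- A domain that is Artinian modulo an ideal for which it is adically complete is local. -/
theorem IsLocalRing.of_isAdicComplete_of_isArtinianRing {O : Type*} [CommRing O] [IsDomain O]
    (J : Ideal O) [IsAdicComplete J O] [IsArtinianRing (O ⧸ J)] : IsLocalRing O := by
  have hjac : J ≤ Ideal.jacobson ⊥ := IsAdicComplete.le_jacobson_bot J
  have hunit : ∀ z, z - 1 ∈ J → IsUnit z := fun z hz => by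
    have := Ideal.mem_jacobson_bot.mp (hjac hz) 1
    simpa using this
  have key : ∀ x : O, IsUnit x ∨ ∃ n, x ^ n ∈ J := by
    intro x
    obtain ⟨n, y, hy⟩ := IsArtinian.exists_pow_succ_smul_dvd (M := O ⧸ J)
      (Ideal.Quotient.mk J x) 1
    obtain ⟨y, rfl⟩ := Ideal.Quotient.mk_surjective y
    set X := Ideal.Quotient.mk J x
    set Y := Ideal.Quotient.mk J y
    have h1 : X ^ n * (X * Y) = X ^ n := by
      simpa [pow_succ, mul_assoc] using hy
    have h2 : ∀ k, X ^ n * (X * Y) ^ k = X ^ n := by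
      intro k
      induction k with
      | zero => simp
      | succ k ih => rw [pow_succ', ← mul_assoc, h1, ih]
    -- The exponent is `n + 1`, not `n`, so that it is positive: a unit lift of `E` then forces `x`
    -- to be a unit even when `n = 0`.
    let E := (X * Y) ^ (n + 1)
    have hXE : X ^ (n + 1) * E = X ^ (n + 1) := by
      rw [pow_succ', mul_assoc, h2]
    have hE : E * E = E := by
      change (X * Y) ^ (n + 1) * E = (X * Y) ^ (n + 1)
      rw [mul_pow, mul_right_comm, hXE]
    let e := (x * y) ^ (n + 1)
    have he : Ideal.Quotient.mk J e = E := by simp [e, E, X, Y]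
    have hidem : e * e - e ∈ J := by
      rw [← Ideal.Quotient.eq_zero_iff_mem, map_sub, map_mul, he, hE, sub_self]
    rcases HenselianRing.mem_or_sub_one_mem J e hidem with h0 | h0
    · right
      refine ⟨n + 1, ?_⟩
      have : E = 0 := by rwa [← he, Ideal.Quotient.eq_zero_iff_mem]
      rw [← Ideal.Quotient.eq_zero_iff_mem, map_pow]
      change X ^ (n + 1) = 0
      rw [← hXE, this, mul_zero]
    · left
      exact isUnit_of_mul_isUnit_left ((isUnit_pow_iff n.succ_ne_zero).mp (hunit e h0))
  refine IsLocalRing.of_isUnit_or_isUnit_one_sub_self fun x => ?_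
  rcases key x with h | ⟨n, hn⟩
  · exact Or.inl h
  · right
    have : IsUnit (1 - x ^ n) := hunit _ (by simpa using hn)
    exact isUnit_of_dvd_unit (one_sub_dvd_one_sub_pow x n) this

/-- A domain that is finite over a complete Noetherian local ring is local. -/
theorem IsLocalRing.of_finite_of_isPrecomplete {B O : Type*} [CommRing B] [IsNoetherianRing B]
    [IsLocalRing B] [IsPrecomplete (maximalIdeal B) B] [CommRing O] [IsDomain O] [Algebra B O]
    [Module.Finite B O] : ∃ _ : IsLocalRing O,
      ∀ b ∈ maximalIdeal B, algebraMap B O b ∈ maximalIdeal O := by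
  have hpre : IsPrecomplete (maximalIdeal B) O := IsPrecomplete.of_finite _
  have hac : IsAdicComplete (maximalIdeal B) O := {}
  let J := (maximalIdeal B).map (algebraMap B O)
  have hJ : IsAdicComplete J O := (IsAdicComplete.map_algebraMap_iff _ _).mpr hac
  let _ : Algebra (B ⧸ maximalIdeal B) (O ⧸ J) :=
    Ideal.Quotient.algebraQuotientOfLEComap Ideal.le_comap_map
  have : IsScalarTower B (B ⧸ maximalIdeal B) (O ⧸ J) := IsScalarTower.of_algebraMap_eq' rfl
  let _ : Field (B ⧸ maximalIdeal B) := Ideal.Quotient.field _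
  have : Module.Finite (B ⧸ maximalIdeal B) (O ⧸ J) :=
    Module.Finite.of_restrictScalars_finite B _ _
  have : IsArtinianRing (O ⧸ J) := isArtinian_of_tower (B ⧸ maximalIdeal B) inferInstance
  have hloc := IsLocalRing.of_isAdicComplete_of_isArtinianRing J
  exact ⟨hloc, fun b hb => (IsAdicComplete.le_jacobson_bot J).trans
    (IsLocalRing.jacobson_eq_maximalIdeal ⊥ bot_ne_top).le (Ideal.mem_map_of_mem _ hb)⟩

/-- Generators of `S` over `R` serve as constant series: expand every coefficient in them and
collect. -/
theorem MvPowerSeries.map_finite {σ R S : Type*} [CommRing R] [CommRing S] [Algebra R S]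
    [Module.Finite R S] : (MvPowerSeries.map (σ := σ) (algebraMap R S)).Finite := by
  obtain ⟨n, g, hg⟩ := Module.Finite.exists_fin (R := R) (M := S)
  let _ := (MvPowerSeries.map (σ := σ) (algebraMap R S)).toAlgebra
  refine ⟨?_⟩
  suffices h : Submodule.span (MvPowerSeries σ R)
      (Set.range fun i => (MvPowerSeries.C (g i) : MvPowerSeries σ S)) = ⊤ by
    rw [← h]
    exact Submodule.fg_span (Set.finite_range _)
  rw [eq_top_iff]
  intro f _
  have : ∀ t, ∃ c : Fin n → R, ∑ i, c i • g i = MvPowerSeries.coeff t f := by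
    intro t
    rw [← Submodule.mem_span_range_iff_exists_fun, hg]
    trivial
  choose c hc using this
  let F : Fin n → MvPowerSeries σ R := fun i => fun t => c t i
  have hf : f = ∑ i, F i • MvPowerSeries.C (g i) := by
    ext t
    rw [← hc t, map_sum]
    refine Finset.sum_congr rfl fun i _ => ?_
    change _ = MvPowerSeries.coeff t (MvPowerSeries.map (algebraMap R S) (F i) *
      MvPowerSeries.C (g i))
    rw [MvPowerSeries.coeff_mul_C, MvPowerSeries.coeff_map, Algebra.smul_def]
    rfl
  rw [hf]
  refine Submodule.sum_mem _ fun i _ => Submodule.smul_mem _ _ (Submodule.subset_span ⟨i, rfl⟩)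

section Padic

variable (p : ℕ) [Fact p.Prime]

open scoped MvPowerSeries.WithPiTopology in
theorem MvPowerSeries.isPrecomplete_padicInt (m : ℕ) (I : Ideal (MvPowerSeries (Fin m) ℤ_[p])) :
    IsPrecomplete I (MvPowerSeries (Fin m) ℤ_[p]) := by
  have : CompactSpace (MvPowerSeries (Fin m) ℤ_[p]) :=
    inferInstanceAs (CompactSpace ((Fin m →₀ ℕ) → ℤ_[p]))
  exact IsPrecomplete.of_compactSpace I

/-- Finitely many generators of the maximal ideal give a uniform `r < 1`, so its `k`-th power maps
into the ball of radius `r ^ k`. -/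
theorem IsLocalRing.continuous_algHom_padicAlgCl {O : Type*} [CommRing O] [IsNoetherianRing O]
    [IsLocalRing O] [Algebra ℤ_[p] O] (hp : (p : O) ∈ maximalIdeal O)
    (l : O →ₐ[ℤ_[p]] PadicAlgCl p) :
    @Continuous O (PadicAlgCl p) (maximalIdeal O).adicTopology _ l := by
  have hunit : ∀ x ∈ maximalIdeal O, ∀ y, IsUnit (1 + x * y) := by
    intro x hx y
    have h1 : -(x * y) ∈ maximalIdeal O := neg_mem (Ideal.mul_mem_right _ _ hx)
    have := IsLocalRing.isUnit_one_sub_self_of_mem_nonunits _ h1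
    rwa [sub_neg_eq_add] at this
  have hle : ∀ x, ‖l x‖ ≤ 1 := fun x =>
    PadicAlgCl.norm_algHom_le_one p l x fun q => hunit _ hp _
  let D (r : ℝ) (hr : 0 ≤ r) : Ideal O :=
    { carrier := {x | ‖l x‖ ≤ r}
      add_mem' := fun {a b} ha hb => by
        rw [Set.mem_ofPred_eq, map_add]
        exact (PadicAlgCl.isNonarchimedean p _ _).trans (max_le ha hb)
      zero_mem' := by simpa using hr
      smul_mem' := fun c x hx => by
        rw [Set.mem_ofPred_eq, smul_eq_mul, map_mul, norm_mul]
        exact (mul_le_of_le_one_left (norm_nonneg _) (hle c)).trans hx }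
  obtain ⟨G, hG⟩ := (isNoetherianRing_iff_ideal_fg O).mp inferInstance (maximalIdeal O)
  obtain ⟨r, hr0, hr1, hr⟩ : ∃ r : ℝ, ∃ _ : 0 ≤ r, r < 1 ∧ ∀ x ∈ G, ‖l x‖ ≤ r := by
    rcases G.eq_empty_or_nonempty with rfl | hne
    · exact ⟨0, le_rfl, zero_lt_one, by simp⟩
    · obtain ⟨x₀, hx₀, hmax⟩ := G.exists_max_image (fun x => ‖l x‖) hne
      refine ⟨‖l x₀‖, norm_nonneg _, PadicAlgCl.norm_algHom_lt_one p l x₀ fun q => hunit _ ?_ _,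
        hmax⟩
      rw [← hG]
      exact Ideal.subset_span hx₀
  have hmD : maximalIdeal O ≤ D r hr0 := by
    rw [← hG, Ideal.span_le]
    exact fun x hx => hr x hx
  have hpow : ∀ k, maximalIdeal O ^ k ≤ D (r ^ k) (pow_nonneg hr0 k) := by
    intro k
    induction k with
    | zero =>
      intro x _
      simpa [D] using hle x
    | succ k ih =>
      rw [pow_succ, Ideal.mul_le]
      intro a ha b hb
      change ‖l (a * b)‖ ≤ r ^ (k + 1)
      rw [map_mul, norm_mul, pow_succ]
      exact mul_le_mul (ih ha) (hmD hb) (norm_nonneg _) (pow_nonneg hr0 k)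
  let _ : TopologicalSpace O := (maximalIdeal O).adicTopology
  have : IsTopologicalRing O := (maximalIdeal O).nonarchimedean.toIsTopologicalRing
  refine continuous_of_continuousAt_zero l ?_
  rw [ContinuousAt, map_zero, (maximalIdeal O).hasBasis_nhds_zero_adic.tendsto_iff
    Metric.nhds_basis_ball]
  intro ε hε
  obtain ⟨k, hk⟩ := exists_pow_lt_of_lt_one hε hr1
  refine ⟨k, trivial, fun x hx => ?_⟩
  rw [mem_ball_zero_iff]
  exact (hpow k hx).trans_lt hk

/-- A domain which is a finite extension of a power series ring over `ℤ_[p]`. -/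
theorem exists_continuous_algHom_of_finite_mvPowerSeries {O : Type*} [CommRing O] [IsDomain O]
    [Algebra ℤ_[p] O] {m : ℕ} (φ : MvPowerSeries (Fin m) ℤ_[p] →ₐ[ℤ_[p]] O)
    (hinj : Function.Injective φ) (hfin : φ.Finite) (S : Set O) (hS : S.Countable)
    (hS0 : ∀ s ∈ S, s ≠ 0) :
    ∃ (_ : IsLocalRing O) (l : O →ₐ[ℤ_[p]] PadicAlgCl p),
      @Continuous O (PadicAlgCl p) (IsLocalRing.maximalIdeal O).adicTopology _ l ∧
      ∀ s ∈ S, l s ≠ 0 := by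
  let _ : Algebra (MvPowerSeries (Fin m) ℤ_[p]) O := φ.toRingHom.toAlgebra
  have hF : Module.Finite (MvPowerSeries (Fin m) ℤ_[p]) O := hfin
  have : FaithfulSMul (MvPowerSeries (Fin m) ℤ_[p]) O :=
    (faithfulSMul_iff_algebraMap_injective _ _).mpr hinj
  have : IsScalarTower ℤ_[p] (MvPowerSeries (Fin m) ℤ_[p]) O :=
    IsScalarTower.of_algebraMap_eq fun c => (φ.commutes c).symm
  have := MvPowerSeries.isPrecomplete_padicInt p m (maximalIdeal _)
  obtain ⟨hloc, hmem⟩ := IsLocalRing.of_finite_of_isPrecomplete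
    (B := MvPowerSeries (Fin m) ℤ_[p]) (O := O)
  have : IsNoetherianRing O := IsNoetherianRing.of_finite (MvPowerSeries (Fin m) ℤ_[p]) O
  have hp : (p : O) ∈ maximalIdeal O := by
    have h1 : (p : MvPowerSeries (Fin m) ℤ_[p]) ∈ maximalIdeal _ := by
      rw [mem_maximalIdeal, mem_nonunits_iff, MvPowerSeries.isUnit_iff_constantCoeff, map_natCast]
      exact PadicInt.p_nonunit
    simpa using hmem _ h1
  obtain ⟨l, hl⟩ := exists_algHom_padicAlgCl_ne_zero p (A := O)
    (AlgHom.id ℤ_[p] (MvPowerSeries (Fin m) ℤ_[p])) Function.injective_id S hS hS0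
  exact ⟨hloc, l, IsLocalRing.continuous_algHom_padicAlgCl p hp l, hl⟩

end Padic

end LocalRings

/-! ### Completeness along a principal ideal -/

section PrincipalAdic

theorem Submodule.mem_span_singleton_pow_smul_top_iff {B M : Type*} [CommRing B] [AddCommGroup M]
    [Module B M] (ϖ : B) (n : ℕ) (x : M) :
    x ∈ (Ideal.span {ϖ} ^ n • ⊤ : Submodule B M) ↔ ∃ y, x = ϖ ^ n • y := by
  rw [Ideal.span_singleton_pow, Submodule.ideal_span_singleton_smul,
    Submodule.mem_smul_pointwise_iff_exists]
  simp [eq_comm]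

/-- Successive approximation: over a `ϖ`-complete ring, a submodule `Q` of a `ϖ`-separated module
with `Q ⊆ ⟨g⟩ + ϖ Q` is contained in `⟨g⟩`. -/
theorem Submodule.mem_span_range_of_isPrecomplete {B M ι : Type*} [CommRing B] [AddCommGroup M]
    [Module B M] [Fintype ι] (ϖ : B) [IsPrecomplete (Ideal.span {ϖ}) B]
    [IsHausdorff (Ideal.span {ϖ}) M] (Q : Submodule B M) (g : ι → M)
    (h : ∀ x ∈ Q, ∃ a : ι → B, ∃ y ∈ Q, x = ∑ i, a i • g i + ϖ • y) (x : M) (hx : x ∈ Q) :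
    x ∈ Submodule.span B (Set.range g) := by
  choose! a nxt hnxt hstep using h
  let y : ℕ → M := fun k => nxt^[k] x
  have hy : ∀ k, y k ∈ Q := by
    intro k
    induction k with
    | zero => exact hx
    | succ k ih =>
      simp only [y, Function.iterate_succ_apply']
      exact hnxt _ ih
  -- Iterating `x = ∑ aᵢ gᵢ + ϖ y` produces these partial sums of `ϖ`-adic series; their limits are
  -- the coefficients of `x`.
  let s : ι → ℕ → B := fun i n => ∑ k ∈ Finset.range n, ϖ ^ k * a (y k) i
  have hs : ∀ n, x = ∑ i, s i n • g i + ϖ ^ n • y n := by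
    intro n
    induction n with
    | zero => simp [s, y]
    | succ n ih =>
      have h1 : y n = ∑ i, a (y n) i • g i + ϖ • y (n + 1) := by
        simp only [y, Function.iterate_succ_apply']
        exact hstep _ (hy n)
      rw [ih]
      conv_lhs => rw [h1]
      simp only [s, Finset.sum_range_succ, add_smul, Finset.sum_add_distrib, smul_add,
        Finset.smul_sum, smul_smul, pow_succ]
      rw [add_assoc]
  have hlim : ∀ i, ∃ b, ∀ n, s i n ≡ b [SMOD (Ideal.span {ϖ} ^ n • ⊤ : Ideal B)] := by
    intro i
    refine IsPrecomplete.prec inferInstance fun {m n} hmn => ?_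
    rw [SModEq.comm, SModEq.sub_mem, Submodule.mem_span_singleton_pow_smul_top_iff]
    induction n, hmn using Nat.le_induction with
    | base => exact ⟨0, by simp⟩
    | succ n hmn ih =>
      obtain ⟨c, hc⟩ := ih
      refine ⟨c + ϖ ^ (n - m) * a (y n) i, ?_⟩
      have h2 : s i (n + 1) = s i n + ϖ ^ n * a (y n) i := Finset.sum_range_succ _ _
      have h3 : ϖ ^ n = ϖ ^ m * ϖ ^ (n - m) := by rw [← pow_add, Nat.add_sub_cancel' hmn]
      rw [h2, h3, smul_eq_mul]
      rw [smul_eq_mul] at hc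
      linear_combination hc
  choose b hb using hlim
  have hxb : x - ∑ i, b i • g i = 0 := by
    refine IsHausdorff.haus (I := Ideal.span {ϖ}) inferInstance _ fun n => ?_
    rw [SModEq.zero, Submodule.mem_span_singleton_pow_smul_top_iff]
    have : ∀ i, ∃ c, s i n - b i = ϖ ^ n • c := fun i => by
      rw [← Submodule.mem_span_singleton_pow_smul_top_iff]
      exact SModEq.sub_mem.mp (hb i n)
    choose c hc using this
    refine ⟨∑ i, c i • g i + y n, ?_⟩
    conv_lhs => rw [hs n]
    rw [add_sub_right_comm, ← Finset.sum_sub_distrib, smul_add, Finset.smul_sum]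
    congr 1
    refine Finset.sum_congr rfl fun i _ => ?_
    rw [← sub_smul, hc, smul_assoc]
  rw [sub_eq_zero.mp hxb]
  exact Submodule.sum_mem _ fun i _ => Submodule.smul_mem _ _ (Submodule.subset_span ⟨i, rfl⟩)

/-- A quotient of a `ϖ`-complete ring that is Noetherian modulo `ϖ` is `ϖ`-complete as soon as it
has no `ϖ`-torsion. -/
theorem IsAdicComplete.of_surjective_of_torsionFree {T A : Type*} [CommRing T] [CommRing A]
    [Algebra T A] (hsurj : Function.Surjective (algebraMap T A)) (ϖ : T)
    [IsAdicComplete (Ideal.span {ϖ}) T] [IsNoetherianRing (T ⧸ Ideal.span {ϖ})]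
    (hreg : ∀ a : A, algebraMap T A ϖ * a = 0 → a = 0) :
    IsAdicComplete (Ideal.span {algebraMap T A ϖ}) A := by
  rw [← Set.image_singleton, ← Ideal.map_span, IsAdicComplete.map_algebraMap_iff]
  have : Module.Finite T A := Module.Finite.of_surjective (Algebra.linearMap T A) hsurj
  have hpre : IsPrecomplete (Ideal.span {ϖ}) A := IsPrecomplete.of_finite _
  suffices h : IsHausdorff (Ideal.span {ϖ}) A from {}
  let I := Ideal.span {ϖ}
  let P := RingHom.ker (algebraMap T A)
  -- Only the image of the kernel `P` modulo `ϖ` is known to be finitely generated; lift its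
  -- generators to `G` inside `P`.
  obtain ⟨G, hGP, hG⟩ : ∃ G : Finset T, (G : Set T) ⊆ P ∧
      ∀ z ∈ P, ∃ w ∈ Ideal.span (G : Set T), ∃ t, z = w + ϖ * t := by
    have hfg : (Ideal.span (Ideal.Quotient.mk I '' (P : Set T))).FG :=
      (isNoetherianRing_iff_ideal_fg _).mp inferInstance _
    obtain ⟨G', hG'P, hG'⟩ := (Submodule.fg_span_iff_fg_span_finset_subset _).mp hfg
    classical
    obtain ⟨G, hGP, rfl⟩ := Finset.subset_set_image_iff.mp hG'P
    refine ⟨G, hGP, fun z hz => ?_⟩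
    have h1 : Ideal.Quotient.mk I z ∈ Ideal.map (Ideal.Quotient.mk I) (Ideal.span (G : Set T)) := by
      rw [Ideal.map_span, ← Finset.coe_image]
      change _ ∈ Submodule.span _ _
      rw [← hG']
      exact Submodule.subset_span ⟨z, hz, rfl⟩
    obtain ⟨w, hw, hwz⟩ := (Ideal.mem_map_iff_of_surjective _ Ideal.Quotient.mk_surjective).mp h1
    rw [Ideal.Quotient.eq, ← neg_mem_iff, neg_sub, Ideal.mem_span_singleton] at hwz
    obtain ⟨t, ht⟩ := hwz
    exact ⟨w, hw, t, by rw [← ht]; ring⟩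
  -- `Q` is the preimage of the intersection of the `ϖ ^ n A`. Successive approximation will show
  -- that it lies in the span of `G`, hence in `P`, which is separatedness.
  let Q : Ideal T :=
    { carrier := {t | ∀ n, ∃ a, algebraMap T A t = algebraMap T A ϖ ^ n * a}
      add_mem' := fun {s t} hs ht n => by
        obtain ⟨a, ha⟩ := hs n
        obtain ⟨b, hb⟩ := ht n
        exact ⟨a + b, by rw [map_add, ha, hb, mul_add]⟩
      zero_mem' := fun n => ⟨0, by simp⟩
      smul_mem' := fun c t ht n => by
        obtain ⟨a, ha⟩ := ht n
        exact ⟨algebraMap T A c * a, by rw [smul_eq_mul, map_mul, ha]; ring⟩ }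
  have hspan : ∀ x ∈ Q, x ∈ Submodule.span T (Set.range ((↑) : G → T)) := by
    intro x hx
    refine Submodule.mem_span_range_of_isPrecomplete ϖ Q _ (fun x hx => ?_) x hx
    obtain ⟨a, ha⟩ := hx 1
    obtain ⟨t, rfl⟩ := hsurj a
    obtain ⟨w, hw, t', ht'⟩ := hG (x - ϖ * t) (by
      rw [RingHom.mem_ker, map_sub, map_mul, ha, pow_one, sub_self])
    have hw' := hw
    rw [← Subtype.range_coe (s := (G : Set T))] at hw'
    obtain ⟨c, hc⟩ := (Submodule.mem_span_range_iff_exists_fun T).mp hw'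
    have hwP : algebraMap T A w = 0 := (Ideal.span_le.mpr hGP) hw
    have hxw : x = w + ϖ * (t + t') := by linear_combination ht'
    refine ⟨c, t + t', fun n => ?_, ?_⟩
    -- Torsion-freeness cancels one `ϖ`, so the remainder `t + t'` stays in `Q`; hence the index `n
    -- + 1`.
    · obtain ⟨a, ha⟩ := hx (n + 1)
      refine ⟨a, sub_eq_zero.mp (hreg _ ?_)⟩
      rw [hxw, map_add, hwP, zero_add, map_mul] at ha
      linear_combination ha
    · rw [smul_eq_mul, hxw]
      congr 1
      exact hc.symm
  refine ⟨fun a ha => ?_⟩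
  obtain ⟨x, rfl⟩ := hsurj a
  have hxQ : x ∈ Q := by
    intro n
    have := ha n
    rw [SModEq.zero, Submodule.mem_span_singleton_pow_smul_top_iff] at this
    obtain ⟨y, hy⟩ := this
    exact ⟨y, by rw [hy, Algebra.smul_def, map_pow]⟩
  have h1 := hspan x hxQ
  rw [Subtype.range_coe_subtype] at h1
  exact (Ideal.span_le.mpr hGP) h1

/-- Lifting a homomorphism to the adic completion of its source. -/
theorem AdicCompletion.exists_lift {Z R C : Type*} [CommRing Z] [CommRing R] [CommRing C]
    [Algebra Z R] [Algebra Z C] (ϖ : Z)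
    [IsAdicComplete (Ideal.span {algebraMap Z C ϖ}) C] (θ : R →ₐ[Z] C) :
    ∃ Φ : AdicCompletion (Ideal.span {algebraMap Z R ϖ}) R →ₐ[Z] C,
      (∀ r, Φ (AdicCompletion.of _ R r) = θ r) ∧
      ((∀ k r, (∃ c, θ r = algebraMap Z C ϖ ^ k * c) → ∃ c, r = algebraMap Z R ϖ ^ k * c) →
        Function.Injective Φ) := by
  set I := Ideal.span {algebraMap Z R ϖ} with hI
  set J := Ideal.span {algebraMap Z C ϖ} with hJ
  have hle : ∀ k, I ^ k ≤ (J ^ k).comap θ := by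
    intro k
    rw [hI, hJ, Ideal.span_singleton_pow, Ideal.span_singleton_pow, Ideal.span_singleton_le_iff_mem,
      Ideal.mem_comap, map_pow, AlgHom.commutes]
    exact Ideal.mem_span_singleton_self _
  let f : (k : ℕ) → AdicCompletion I R →ₐ[Z] C ⧸ J ^ k := fun k =>
    (Ideal.quotientMapₐ (J ^ k) θ (hle k)).comp ((AdicCompletion.evalₐ I k).restrictScalars Z)
  have hfmk : ∀ k x r, AdicCompletion.evalₐ I k x = Ideal.Quotient.mk _ r →
      f k x = Ideal.Quotient.mk _ (θ r) := by
    intro k x r h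
    change Ideal.quotientMapₐ (J ^ k) θ (hle k) (AdicCompletion.evalₐ I k x) = _
    rw [h]
    rfl
  have hcompat : ∀ {m n : ℕ} (hmn : m ≤ n),
      (Ideal.Quotient.factorₐ Z (Ideal.pow_le_pow_right hmn)).comp (f n) = f m := by
    intro m n hmn
    ext x
    obtain ⟨s, rfl⟩ := AdicCompletion.mk_surjective I R x
    rw [hfmk m _ (s m) (AdicCompletion.evalₐ_mk ..), AlgHom.comp_apply,
      hfmk n _ (s n) (AdicCompletion.evalₐ_mk ..)]
    change Ideal.Quotient.mk _ (θ (s n)) = _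
    rw [Ideal.Quotient.eq, ← map_sub]
    refine hle m ?_
    rw [← Ideal.Quotient.eq]
    exact AdicCompletion.Ideal.mk_eq_mk I hmn s
  refine ⟨IsAdicComplete.liftAlgHom J f hcompat, fun r => ?_, fun hinj => ?_⟩
  · refine (IsHausdorff.eq_iff_smodEq (I := J)).mpr fun k => ?_
    rw [smul_eq_mul, Ideal.mul_top, SModEq.sub_mem, ← Ideal.Quotient.eq,
      IsAdicComplete.mk_liftAlgHom]
    exact hfmk k _ r (AdicCompletion.evalₐ_of ..)
  -- An element of the kernel has, at each level `k`, a representative `r` with `θ r` divisible by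
  -- `ϖ ^ k`; by assumption so is `r`.
  · rw [injective_iff_map_eq_zero]
    intro x hx
    refine AdicCompletion.ext_evalₐ fun k => ?_
    obtain ⟨r, hr⟩ := Ideal.Quotient.mk_surjective (AdicCompletion.evalₐ I k x)
    have h1 : Ideal.Quotient.mk (J ^ k) (θ r) = 0 := by
      rw [← hfmk k x r hr.symm, ← IsAdicComplete.mk_liftAlgHom J f hcompat, hx, _root_.map_zero]
    rw [Ideal.Quotient.eq_zero_iff_mem, hJ, Ideal.span_singleton_pow,
      Ideal.mem_span_singleton] at h1
    obtain ⟨c, hc⟩ := hinj k r h1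
    rw [← hr, _root_.map_zero, Ideal.Quotient.eq_zero_iff_mem, hI, Ideal.span_singleton_pow,
      Ideal.mem_span_singleton]
    exact ⟨c, hc⟩

end PrincipalAdic

/-! ### Formal Noether normalization -/

section AffineFormal

variable (p : ℕ) [Fact p.Prime]

theorem MvPowerSeries.isAdicComplete_padicInt (m : ℕ) :
    IsAdicComplete (Ideal.span {(p : MvPowerSeries (Fin m) ℤ_[p])})
      (MvPowerSeries (Fin m) ℤ_[p]) := by
  have h1 := MvPowerSeries.isPrecomplete_padicInt p m
    (Ideal.span {(p : MvPowerSeries (Fin m) ℤ_[p])})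
  have h2 : IsHausdorff (Ideal.span {(p : MvPowerSeries (Fin m) ℤ_[p])})
      (MvPowerSeries (Fin m) ℤ_[p]) := by
    refine IsHausdorff.of_isLocalRing _ _ ?_
    rw [Ne, Ideal.span_singleton_eq_top, MvPowerSeries.isUnit_iff_constantCoeff, map_natCast]
    exact PadicInt.p_nonunit
  exact {}

/-- The `p`-adic completion of a polynomial ring over `ℤ_[p]` embeds in the power series ring. -/
theorem exists_injective_adicCompletion_mvPolynomial (m : ℕ) :
    ∃ ι : AdicCompletion (Ideal.span {algebraMap ℤ_[p] (MvPolynomial (Fin m) ℤ_[p]) p})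
      (MvPolynomial (Fin m) ℤ_[p]) →ₐ[ℤ_[p]] MvPowerSeries (Fin m) ℤ_[p],
      Function.Injective ι := by
  have := MvPowerSeries.isAdicComplete_padicInt p m
  have h1 : IsAdicComplete (Ideal.span {algebraMap ℤ_[p] (MvPowerSeries (Fin m) ℤ_[p]) p})
      (MvPowerSeries (Fin m) ℤ_[p]) := by
    rwa [map_natCast]
  obtain ⟨ι, -, hι⟩ := AdicCompletion.exists_lift (p : ℤ_[p])
    (MvPolynomial.coeToMvPowerSeries.algHom (σ := Fin m) (R := ℤ_[p]) ℤ_[p])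
  refine ⟨ι, hι fun k r ⟨c, hc⟩ => ?_⟩
  rw [MvPolynomial.algebraMap_eq, ← map_pow]
  change MvPolynomial.C ((p : ℤ_[p]) ^ k) ∣ r
  rw [MvPolynomial.C_dvd_iff_dvd_coeff]
  intro t
  refine ⟨MvPowerSeries.coeff t c, ?_⟩
  have := congrArg (MvPowerSeries.coeff t) hc
  rw [← map_pow, MvPowerSeries.algebraMap_apply, MvPowerSeries.coeff_C_mul] at this
  simpa using this

/-- Formal Noether normalization: a `p`-complete `p`-torsion-free `ℤ_[p]`-algebra, of finite type
modulo `p`, is finite over the `p`-adic completion of a polynomial ring. -/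
theorem exists_finite_injective_adicCompletion_mvPolynomial {A : Type*} [CommRing A]
    [Nontrivial A] [Algebra ℤ_[p] A]
    [IsAdicComplete (Ideal.span {algebraMap ℤ_[p] A p}) A]
    [Algebra.FiniteType ℤ_[p] (A ⧸ Ideal.span {algebraMap ℤ_[p] A p})]
    (hreg : ∀ a : A, algebraMap ℤ_[p] A p * a = 0 → a = 0) :
    ∃ (m : ℕ) (Φ : AdicCompletion
        (Ideal.span {algebraMap ℤ_[p] (MvPolynomial (Fin m) ℤ_[p]) p})
        (MvPolynomial (Fin m) ℤ_[p]) →ₐ[ℤ_[p]] A),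
      Function.Injective Φ ∧ Φ.Finite := by
  set J := Ideal.span {algebraMap ℤ_[p] A p} with hJ
  have hJtop : J ≠ ⊤ := by
    intro h
    have h1 := IsAdicComplete.le_jacobson_bot J
    rw [h, top_le_iff, Ideal.jacobson_eq_top_iff] at h1
    exact bot_ne_top h1
  have : Nontrivial (A ⧸ J) := Ideal.Quotient.nontrivial_iff.mpr hJtop
  let k := ℤ_[p] ⧸ IsLocalRing.maximalIdeal ℤ_[p]
  let _ : Field k := Ideal.Quotient.field _
  let _ : Algebra k (A ⧸ J) := Ideal.Quotient.algebraQuotientOfLEComap (by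
    rw [PadicInt.maximalIdeal_eq_span_p, Ideal.span_singleton_le_iff_mem, Ideal.mem_comap]
    exact Ideal.mem_span_singleton_self _)
  have hk : ∀ c : ℤ_[p], algebraMap k (A ⧸ J) (Ideal.Quotient.mk _ c) =
      Ideal.Quotient.mk J (algebraMap ℤ_[p] A c) := fun c => rfl
  have : IsScalarTower ℤ_[p] k (A ⧸ J) := IsScalarTower.of_algebraMap_eq' rfl
  have : Algebra.FiniteType k (A ⧸ J) :=
    Algebra.FiniteType.of_restrictScalars_finiteType ℤ_[p] k (A ⧸ J)
  -- Noether normalization takes place over the residue field; the images of the variables are then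
  -- lifted to `A`.
  obtain ⟨m, g, hginj, hgfin⟩ := exists_finite_inj_algHom_of_fg k (A ⧸ J)
  choose y hy using fun i => Ideal.Quotient.mk_surjective (g (MvPolynomial.X i))
  let θ : MvPolynomial (Fin m) ℤ_[p] →ₐ[ℤ_[p]] A := MvPolynomial.aeval y
  have hθ : ∀ f, Ideal.Quotient.mk J (θ f) =
      g (MvPolynomial.map (Ideal.Quotient.mk (IsLocalRing.maximalIdeal ℤ_[p])) f) := by
    intro f
    change ((Ideal.Quotient.mk J).comp (θ : _ →+* A)) f = ((g : _ →+* A ⧸ J).comp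
      (MvPolynomial.map (Ideal.Quotient.mk (IsLocalRing.maximalIdeal ℤ_[p])))) f
    congr 1
    refine MvPolynomial.ringHom_ext (fun c => ?_) fun i => ?_
    · simp only [RingHom.comp_apply, MvPolynomial.map_C, RingHom.coe_coe]
      rw [← MvPolynomial.algebraMap_eq, AlgHom.commutes, ← MvPolynomial.algebraMap_eq,
        AlgHom.commutes, hk]
    · simp [θ, hy]
  obtain ⟨Φ, hΦθ, hΦ⟩ := AdicCompletion.exists_lift (p : ℤ_[p]) θ
  refine ⟨m, Φ, hΦ fun n => ?_, ?_⟩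
  -- `θ` reflects divisibility by powers of `p`: injectivity of `g` gives one factor, and
  -- torsion-freeness cancels it from both sides.
  · induction n with
    | zero => exact fun r _ => ⟨r, by simp⟩
    | succ n ih =>
      rintro r ⟨c, hc⟩
      have h0 : MvPolynomial.map (Ideal.Quotient.mk (IsLocalRing.maximalIdeal ℤ_[p])) r = 0 := by
        rw [← map_eq_zero_iff g hginj, ← hθ, hc, Ideal.Quotient.eq_zero_iff_mem, pow_succ', mul_assoc]
        exact Ideal.mul_mem_right _ _ (Ideal.mem_span_singleton_self _)
      obtain ⟨r', hr'⟩ : algebraMap ℤ_[p] (MvPolynomial (Fin m) ℤ_[p]) p ∣ r := by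
        rw [MvPolynomial.algebraMap_eq, MvPolynomial.C_dvd_iff_dvd_coeff]
        intro t
        have := congrArg (MvPolynomial.coeff t) h0
        rwa [MvPolynomial.coeff_map, MvPolynomial.coeff_zero, Ideal.Quotient.eq_zero_iff_mem,
          PadicInt.maximalIdeal_eq_span_p, Ideal.mem_span_singleton] at this
      have h1 : θ r' = algebraMap ℤ_[p] A p ^ n * c := by
        refine sub_eq_zero.mp (hreg _ ?_)
        rw [hr', map_mul, AlgHom.commutes] at hc
        linear_combination hc
      obtain ⟨d, hd⟩ := ih r' ⟨c, h1⟩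
      exact ⟨d, by rw [hr', hd, pow_succ']; ring⟩
  · let R := MvPolynomial (Fin m) ℤ_[p]
    let I := Ideal.span {algebraMap ℤ_[p] R p}
    let B := AdicCompletion I R
    have hBR : IsAdicComplete I B := AdicCompletion.isAdicComplete (Submodule.fg_span_singleton _)
    have hB : IsAdicComplete (Ideal.span {algebraMap R B (algebraMap ℤ_[p] R p)}) B := by
      rw [← Set.image_singleton, ← Ideal.map_span, IsAdicComplete.map_algebraMap_iff]
      exact hBR
    set ϖ := algebraMap R B (algebraMap ℤ_[p] R p) with hϖ
    have hΦϖ : Φ ϖ = algebraMap ℤ_[p] A p := by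
      rw [hϖ]
      exact (hΦθ _).trans (θ.commutes _)
    let _ : Algebra B A := Φ.toRingHom.toAlgebra
    have hA : IsHausdorff (Ideal.span {ϖ}) A := by
      rw [← IsHausdorff.map_algebraMap_iff (S := A), Ideal.map_span, Set.image_singleton]
      change IsHausdorff (Ideal.span {Φ ϖ}) A
      rw [hΦϖ]
      infer_instance
    -- Lifts of module generators modulo `p` generate `A` up to `p A`, and successive approximation
    -- removes the error.
    obtain ⟨n, e, he⟩ : ∃ (n : ℕ) (e : Fin n → A), ∀ x : A, ∃ f : Fin n → R, ∃ z,
        x = ∑ i, θ (f i) * e i + algebraMap ℤ_[p] A p * z := by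
      let _ : Algebra (MvPolynomial (Fin m) k) (A ⧸ J) := g.toRingHom.toAlgebra
      have hfin : Module.Finite (MvPolynomial (Fin m) k) (A ⧸ J) := hgfin
      obtain ⟨n, e', he'⟩ := Module.Finite.exists_fin (R := MvPolynomial (Fin m) k) (M := A ⧸ J)
      choose e he using fun i => Ideal.Quotient.mk_surjective (e' i)
      refine ⟨n, e, fun x => ?_⟩
      have hx : Ideal.Quotient.mk J x ∈ Submodule.span (MvPolynomial (Fin m) k) (Set.range e') := by
        rw [he']
        trivial
      obtain ⟨c, hc⟩ := (Submodule.mem_span_range_iff_exists_fun _).mp hx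
      choose f hf using fun i => MvPolynomial.map_surjective
        (Ideal.Quotient.mk (IsLocalRing.maximalIdeal ℤ_[p])) Ideal.Quotient.mk_surjective (c i)
      have h2 : x - ∑ i, θ (f i) * e i ∈ J := by
        rw [← Ideal.Quotient.eq, ← hc, map_sum]
        refine Finset.sum_congr rfl fun i _ => ?_
        rw [map_mul, hθ, hf, he]
        rfl
      obtain ⟨z, hz⟩ := Ideal.mem_span_singleton.mp h2
      exact ⟨f, z, by linear_combination hz⟩
    change Module.Finite B A
    refine ⟨?_⟩
    have htop : (⊤ : Submodule B A) = Submodule.span B (Set.range e) := by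
      refine (eq_top_iff.mpr fun x hx => ?_).symm
      refine Submodule.mem_span_range_of_isPrecomplete ϖ ⊤ e (fun x _ => ?_) x hx
      obtain ⟨f, z, hz⟩ := he x
      refine ⟨fun i => AdicCompletion.of I R (f i), z, trivial, ?_⟩
      rw [hz, ← hΦϖ]
      congr 1
      refine Finset.sum_congr rfl fun i _ => ?_
      rw [← hΦθ]
      rfl
    rw [htop]
    exact Submodule.fg_span (Set.finite_range _)

end AffineFormal

/-! ### The unit ball of the Tate algebra -/

namespace TateDefs

variable (p : ℕ) [Fact p.Prime]

theorem norm_natCast_prime_pos {K : Type*} [NormedField K] [NormedAlgebra ℚ_[p] K] :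
    0 < ‖(p : K)‖ := by
  rw [norm_pos_iff, ← map_natCast (algebraMap ℚ_[p] K), map_ne_zero]
  exact_mod_cast (Fact.out : p.Prime).ne_zero

theorem norm_natCast_prime_lt_one {K : Type*} [NormedField K] [NormedAlgebra ℚ_[p] K] : ‖(p : K)‖ < 1 := by
  rw [← map_natCast (algebraMap ℚ_[p] K), norm_algebraMap']
  exact Padic.norm_p_lt_one

theorem exists_finset_norm_sub_le (K : Type*) [NormedField K] [NormedAlgebra ℚ_[p] K] [ProperSpace K] :
    ∃ F : Finset K, (∀ x ∈ F, ‖x‖ ≤ 1) ∧ ∀ y : K, ‖y‖ ≤ 1 → ∃ x ∈ F, ‖y - x‖ ≤ ‖(p : K)‖ := by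
  have hp0 : 0 < ‖(p : K)‖ := norm_natCast_prime_pos p
  obtain ⟨t, ht, hfin, hcov⟩ := (isCompact_closedBall (0 : K) 1).finite_cover_balls hp0
  refine ⟨hfin.toFinset, fun x hx => ?_, fun y hy => ?_⟩
  · simpa using ht (hfin.mem_toFinset.mp hx)
  · obtain ⟨x, hx, hxy⟩ := Set.mem_iUnion₂.mp (hcov (show y ∈ Metric.closedBall (0 : K) 1 by
      simpa using hy))
    refine ⟨x, hfin.mem_toFinset.mpr hx, ?_⟩
    rw [← dist_eq_norm]
    exact (Metric.mem_ball.mp hxy).le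

theorem norm_algebraMap_padicInt (K : Type*) [NormedField K] [NormedAlgebra ℚ_[p] K]
    [Algebra ℤ_[p] K] [IsScalarTower ℤ_[p] ℚ_[p] K] (c : ℤ_[p]) : ‖algebraMap ℤ_[p] K c‖ = ‖c‖ := by
  rw [IsScalarTower.algebraMap_apply ℤ_[p] ℚ_[p] K, norm_algebraMap']
  rfl

variable (K : Type*) [NormedField K] [NormedAlgebra ℚ_[p] K]
  [IsUltrametricDist K] [Algebra ℤ_[p] K] [IsScalarTower ℤ_[p] ℚ_[p] K]

/-- The power series in the Tate algebra with coefficients of norm at most one. -/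
def unitBall (n : ℕ) : Subalgebra ℤ_[p] (TateAlgebra K n) where
  carrier := {f | ∀ t, ‖MvPowerSeries.coeff t (f : MvPowerSeries (Fin n) K)‖ ≤ 1}
  mul_mem' {f g} hf hg t := by
    classical
    rw [MulMemClass.coe_mul, MvPowerSeries.coeff_mul]
    refine IsUltrametricDist.norm_sum_le_of_forall_le_of_nonneg zero_le_one fun x _ => ?_
    rw [norm_mul]
    exact mul_le_one₀ (hf _) (norm_nonneg _) (hg _)
  add_mem' {f g} hf hg t := by
    rw [AddMemClass.coe_add, map_add]
    exact (IsUltrametricDist.norm_add_le_max _ _).trans (max_le (hf t) (hg t))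
  algebraMap_mem' c t := by
    classical
    have : ((algebraMap ℤ_[p] (TateAlgebra K n) c : TateAlgebra K n) : MvPowerSeries (Fin n) K) =
        MvPowerSeries.C (algebraMap ℤ_[p] K c) := by
      rw [Subalgebra.coe_algebraMap, MvPowerSeries.algebraMap_apply]
    rw [this, MvPowerSeries.coeff_C]
    split_ifs
    · rw [norm_algebraMap_padicInt]
      exact PadicInt.norm_le_one c
    · simp

variable {K} {n : ℕ}

/-- Translates divisibility by `p ^ k` into a coefficient bound, so that `p`-adic completeness
becomes uniform convergence of coefficients. -/
theorem exists_eq_pow_mul_iff (k : ℕ) (f : unitBall p K n) :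
    (∃ g : unitBall p K n, f = (p : unitBall p K n) ^ k * g) ↔
      ∀ t, ‖MvPowerSeries.coeff t (f : MvPowerSeries (Fin n) K)‖ ≤ ‖(p : K)‖ ^ k := by
  have hcoe : ∀ g : TateAlgebra K n, (((p : TateAlgebra K n) ^ k * g : TateAlgebra K n) :
      MvPowerSeries (Fin n) K) = MvPowerSeries.C ((p : K) ^ k) * (g : MvPowerSeries (Fin n) K) := by
    intro g
    simp
  have hp0 : (p : K) ≠ 0 := norm_pos_iff.mp (norm_natCast_prime_pos p)
  have hpk : (0 : ℝ) < ‖(p : K)‖ ^ k := pow_pos (norm_pos_iff.mpr hp0) k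
  constructor
  · rintro ⟨g, rfl⟩ t
    change ‖MvPowerSeries.coeff t (((p : TateAlgebra K n) ^ k * (g : TateAlgebra K n) :
      TateAlgebra K n) : MvPowerSeries (Fin n) K)‖ ≤ _
    rw [hcoe, MvPowerSeries.coeff_C_mul, norm_mul, norm_pow]
    exact mul_le_of_le_one_right hpk.le (g.2 t)
  · intro h
    let g : TateAlgebra K n := ((p : K) ^ k)⁻¹ • (f : TateAlgebra K n)
    have hg : ∀ t, MvPowerSeries.coeff t (g : MvPowerSeries (Fin n) K) =
        ((p : K) ^ k)⁻¹ * MvPowerSeries.coeff t (f : MvPowerSeries (Fin n) K) := fun t => rfl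
    refine ⟨⟨g, fun t => ?_⟩, Subtype.ext (Subtype.ext (MvPowerSeries.ext fun t => ?_))⟩
    · rw [hg, norm_mul, norm_inv, norm_pow, inv_mul_le_iff₀ hpk, mul_one]
      exact h t
    · change _ = MvPowerSeries.coeff t (((p : TateAlgebra K n) ^ k * g :
        TateAlgebra K n) : MvPowerSeries (Fin n) K)
      rw [hcoe, MvPowerSeries.coeff_C_mul, hg, mul_inv_cancel_left₀ (pow_ne_zero _ hp0)]

variable (K n)

theorem unitBall_isAdicComplete [CompleteSpace K] :
    IsAdicComplete (Ideal.span {(p : unitBall p K n)}) (unitBall p K n) where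
  haus' f hf := by
    refine Subtype.ext (Subtype.ext (MvPowerSeries.ext fun t => ?_))
    have h1 : ∀ k, ‖MvPowerSeries.coeff t (f : MvPowerSeries (Fin n) K)‖ ≤ ‖(p : K)‖ ^ k := by
      intro k
      have := hf k
      rw [SModEq.zero, Submodule.mem_span_singleton_pow_smul_top_iff] at this
      exact (exists_eq_pow_mul_iff p k f).mp this t
    have h2 := ge_of_tendsto' (tendsto_pow_atTop_nhds_zero_of_lt_one (norm_nonneg _)
      (norm_natCast_prime_lt_one p (K := K))) h1
    exact norm_le_zero_iff.mp h2
  prec' F hF := by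
    have hF' : ∀ {m k}, m ≤ k → ∀ t, ‖MvPowerSeries.coeff t (F m : MvPowerSeries (Fin n) K) -
        MvPowerSeries.coeff t (F k : MvPowerSeries (Fin n) K)‖ ≤ ‖(p : K)‖ ^ m := by
      intro m k hmk t
      have := hF hmk
      rw [SModEq.sub_mem, Submodule.mem_span_singleton_pow_smul_top_iff] at this
      exact (exists_eq_pow_mul_iff p m _).mp this t
    have hr := norm_natCast_prime_lt_one p (K := K)
    have hpow := tendsto_pow_atTop_nhds_zero_of_lt_one (norm_nonneg (p : K)) hr
    have hlim : ∀ t, ∃ a, Filter.Tendsto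
        (fun k => MvPowerSeries.coeff t (F k : MvPowerSeries (Fin n) K)) Filter.atTop (nhds a) := by
      intro t
      refine cauchySeq_tendsto_of_complete (cauchySeq_of_le_tendsto_0' (fun k => ‖(p : K)‖ ^ k)
        (fun m k hmk => ?_) hpow)
      rw [dist_eq_norm]
      exact hF' hmk t
    choose a ha using hlim
    let A : MvPowerSeries (Fin n) K := fun t => a t
    have hA : ∀ t, MvPowerSeries.coeff t A = a t := fun t => rfl
    have hFa : ∀ m t, ‖MvPowerSeries.coeff t (F m : MvPowerSeries (Fin n) K) - a t‖ ≤
        ‖(p : K)‖ ^ m := by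
      intro m t
      refine le_of_tendsto ((ha t).const_sub _).norm ?_
      filter_upwards [Filter.eventually_ge_atTop m] with k hk
      exact hF' hk t
    have hamem : A ∈ TateAlgebra K n := by
      rw [mem_tateAlgebra_iff, Metric.tendsto_nhds]
      intro ε hε
      obtain ⟨m, hm⟩ := exists_pow_lt_of_lt_one hε hr
      have h1 := (mem_tateAlgebra_iff _).mp (F m : TateAlgebra K n).2
      rw [Metric.tendsto_nhds] at h1
      filter_upwards [h1 ε hε] with t ht
      rw [Real.dist_0_eq_abs, abs_norm] at ht ⊢
      have h2 : MvPowerSeries.coeff t A =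
        MvPowerSeries.coeff t (F m : MvPowerSeries (Fin n) K) -
          (MvPowerSeries.coeff t (F m : MvPowerSeries (Fin n) K) - a t) := by
        rw [sub_sub_cancel, hA]
      rw [h2, sub_eq_add_neg]
      refine (IsUltrametricDist.norm_add_le_max _ _).trans_lt (max_lt ht ?_)
      rw [norm_neg]
      exact (hFa m t).trans_lt hm
    have haball : (⟨A, hamem⟩ : TateAlgebra K n) ∈ unitBall p K n := by
      intro t
      exact le_of_tendsto (ha t).norm (Filter.Eventually.of_forall fun k => (F k).2 t)
    refine ⟨⟨_, haball⟩, fun m => ?_⟩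
    rw [SModEq.sub_mem, Submodule.mem_span_singleton_pow_smul_top_iff]
    exact (exists_eq_pow_mul_iff p m _).mpr (hFa m)

/-- Modulo `p` the unit ball of the Tate algebra is an algebra of finite type. -/
theorem unitBall_finiteType [ProperSpace K] :
    Algebra.FiniteType ℤ_[p] (unitBall p K n ⧸ Ideal.span {(p : unitBall p K n)}) := by
  classical
  obtain ⟨F, hF1, hF⟩ := exists_finset_norm_sub_le p K
  have hCmem : ∀ x : K, ‖x‖ ≤ 1 → algebraMap K (TateAlgebra K n) x ∈ unitBall p K n := by
    intro x hx t
    change ‖MvPowerSeries.coeff t (MvPowerSeries.C x)‖ ≤ 1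
    rw [MvPowerSeries.coeff_C]
    split_ifs
    · exact hx
    · simp
  have hXT : ∀ t : Fin n →₀ ℕ, (MvPowerSeries.monomial t (1 : K)) ∈ TateAlgebra K n := by
    intro t
    rw [mem_tateAlgebra_iff]
    refine tendsto_const_nhds.congr' ?_
    filter_upwards [(Set.finite_singleton t).compl_mem_cofinite] with s hs
    have hst : s ≠ t := hs
    rw [MvPowerSeries.coeff_monomial, if_neg hst, norm_zero]
  let mon : (Fin n →₀ ℕ) → unitBall p K n := fun t => ⟨⟨_, hXT t⟩, fun s => by
    change ‖MvPowerSeries.coeff s (MvPowerSeries.monomial t (1 : K))‖ ≤ 1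
    rw [MvPowerSeries.coeff_monomial]
    split_ifs <;> simp⟩
  have hmon : ∀ s t, mon (s + t) = mon s * mon t := fun s t =>
    Subtype.ext (Subtype.ext (by
      change _ = MvPowerSeries.monomial s (1 : K) * MvPowerSeries.monomial t (1 : K)
      rw [MvPowerSeries.monomial_mul_monomial, one_mul]))
  let Cx : {x : K // x ∈ F} → unitBall p K n := fun x => ⟨_, hCmem x (hF1 _ x.2)⟩
  let G : Set (unitBall p K n) := Set.range Cx ∪ Set.range fun i => mon (Finsupp.single i 1)
  have hmonG : ∀ t, mon t ∈ Algebra.adjoin ℤ_[p] G := by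
    intro t
    induction t using Finsupp.induction_linear with
    | zero => exact (Algebra.adjoin ℤ_[p] G).one_mem
    | add s t hs ht => rw [hmon]; exact mul_mem hs ht
    | single i k =>
      induction k with
      | zero => rw [Finsupp.single_zero]; exact (Algebra.adjoin ℤ_[p] G).one_mem
      | succ k ih =>
        rw [Finsupp.single_add, hmon]
        exact mul_mem ih (Algebra.subset_adjoin (Or.inr ⟨i, rfl⟩))
  have happrox : ∀ f : unitBall p K n, ∃ h ∈ Algebra.adjoin ℤ_[p] G, ∃ g,
      f - h = (p : unitBall p K n) ^ 1 * g := by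
    intro f
    have hp0 : 0 < ‖(p : K)‖ := norm_natCast_prime_pos p
    have h1 := (mem_tateAlgebra_iff _).mp (f : TateAlgebra K n).2
    have hfin : {t | ¬ ‖MvPowerSeries.coeff t (f : MvPowerSeries (Fin n) K)‖ < ‖(p : K)‖}.Finite :=
      Filter.eventually_cofinite.mp (h1.eventually_lt_const hp0)
    choose x hxF hx using fun t => hF _ (f.2 t)
    -- Modulo `p` only the finitely many coefficients of norm at least `‖p‖` matter, and each may be
    -- replaced by one from the finite net `F`.
    let h : unitBall p K n := ∑ t ∈ hfin.toFinset, Cx ⟨x t, hxF t⟩ * mon t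
    have hcoeff : ∀ s, MvPowerSeries.coeff s (h : MvPowerSeries (Fin n) K) =
        if s ∈ hfin.toFinset then x s else 0 := by
      intro s
      have : (h : MvPowerSeries (Fin n) K) = ∑ t ∈ hfin.toFinset,
          MvPowerSeries.C (x t) * MvPowerSeries.monomial t (1 : K) := by
        simp only [h, AddSubmonoidClass.coe_finsetSum]
        rfl
      rw [this, map_sum]
      simp_rw [MvPowerSeries.coeff_C_mul, MvPowerSeries.coeff_monomial]
      simp
    refine ⟨h, Subalgebra.sum_mem _ fun t _ => mul_mem (Algebra.subset_adjoin (Or.inl ⟨_, rfl⟩))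
      (hmonG t), (exists_eq_pow_mul_iff p 1 _).mpr fun s => ?_⟩
    change ‖MvPowerSeries.coeff s (f : MvPowerSeries (Fin n) K) -
      MvPowerSeries.coeff s (h : MvPowerSeries (Fin n) K)‖ ≤ _
    rw [hcoeff, pow_one]
    split_ifs with hs
    · exact hx s
    · rw [sub_zero]
      simpa using (not_not.mp fun hn => hs (hfin.mem_toFinset.mpr hn)).le
  have hGfin : G.Finite := (Set.finite_range _).union (Set.finite_range _)
  let q := Ideal.Quotient.mkₐ ℤ_[p] (Ideal.span {(p : unitBall p K n)})
  have htop : Algebra.adjoin ℤ_[p] (q '' G) = ⊤ := by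
    rw [eq_top_iff]
    rintro z -
    obtain ⟨f, rfl⟩ := Ideal.Quotient.mk_surjective z
    obtain ⟨h, hh, g, hg⟩ := happrox f
    have : Ideal.Quotient.mk (Ideal.span {(p : unitBall p K n)}) f = q h := by
      refine Ideal.Quotient.eq.mpr ?_
      rw [hg, pow_one]
      exact Ideal.mul_mem_right _ _ (Ideal.mem_span_singleton_self _)
    rw [this, ← AlgHom.map_adjoin]
    exact ⟨h, hh, rfl⟩
  exact ⟨Subalgebra.fg_def.mpr ⟨_, hGfin.image q, htop⟩⟩

end TateDefs

/-! ### Homomorphisms from affinoid algebras -/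

namespace TateDefs

variable (p : ℕ) [Fact p.Prime] {K : Type*} [NormedField K] [NormedAlgebra ℚ_[p] K]
  [IsUltrametricDist K] [Algebra ℤ_[p] K] [IsScalarTower ℤ_[p] ℚ_[p] K]
  {n : ℕ}

theorem coeff_norm_le_norm {K : Type*} [NormedField K] [IsUltrametricDist K] {n : ℕ}
    (f : TateAlgebra K n) (t : Fin n →₀ ℕ) :
    ‖MvPowerSeries.coeff t (f : MvPowerSeries (Fin n) K)‖ ≤ ‖f‖ := by
  have h : ‖MvPowerSeries.coeff t (f : MvPowerSeries (Fin n) K)‖ ≤ MvPowerSeries.gaussNorm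
      (fun a : K => ‖a‖) (fun _ => (1 : ℝ)) (f : MvPowerSeries (Fin n) K) := by
    simpa [Finsupp.prod] using MvPowerSeries.le_gaussNorm _ _ _ (hasGaussNorm f) t
  exact h

/-- Every homomorphism from a Tate algebra to `PadicAlgCl p` is continuous. -/
theorem continuous_algHom_padicAlgCl [FiniteDimensional ℚ_[p] K]
    (l : TateAlgebra K n →ₐ[ℤ_[p]] PadicAlgCl p) :
    Continuous l := by
  have : CompleteSpace K := FiniteDimensional.complete ℚ_[p] K
  have hac := unitBall_isAdicComplete p K n
  -- By completeness `p` lies in the Jacobson radical of the unit ball, so the automatic bound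
  -- applies; scaling by `p ^ k` then gives continuity.
  have hle : ∀ f : unitBall p K n, ‖l f‖ ≤ 1 := by
    intro f
    refine PadicAlgCl.norm_algHom_le_one p (l.comp (unitBall p K n).val) f fun q => ?_
    have h1 : (p : unitBall p K n) ∈ Ideal.jacobson ⊥ :=
      IsAdicComplete.le_jacobson_bot _ (Ideal.mem_span_singleton_self _)
    have := Ideal.mem_jacobson_bot.mp h1 (Polynomial.aeval f q)
    rwa [add_comm] at this
  have hp0 := norm_natCast_prime_pos p (K := K)
  have hnp : ‖(p : PadicAlgCl p)‖ < 1 := norm_natCast_prime_lt_one p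
  refine continuous_of_continuousAt_zero l ?_
  rw [ContinuousAt, map_zero, Metric.tendsto_nhds_nhds]
  intro ε hε
  obtain ⟨k, hk⟩ := exists_pow_lt_of_lt_one hε hnp
  refine ⟨‖(p : K)‖ ^ k, pow_pos hp0 k, fun f hf => ?_⟩
  rw [dist_zero_right] at hf ⊢
  have hfk : ∀ t, ‖MvPowerSeries.coeff t (f : MvPowerSeries (Fin n) K)‖ ≤ ‖(p : K)‖ ^ k :=
    fun t => (coeff_norm_le_norm f t).trans hf.le
  have hfmem : f ∈ unitBall p K n := fun t =>
    (hfk t).trans (pow_le_one₀ (norm_nonneg _) (norm_natCast_prime_lt_one p).le)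
  obtain ⟨g, hg⟩ := (exists_eq_pow_mul_iff p k ⟨f, hfmem⟩).mpr hfk
  have hfg : f = (p : TateAlgebra K n) ^ k * (g : TateAlgebra K n) := congrArg Subtype.val hg
  rw [hfg, map_mul, map_pow, map_natCast, norm_mul, norm_pow]
  exact (mul_le_of_le_one_right (pow_nonneg (norm_nonneg _) k) (hle g)).trans_lt hk

theorem exists_pow_mul_mem_unitBall (f : TateAlgebra K n) :
    ∃ k, (p : TateAlgebra K n) ^ k * f ∈ unitBall p K n := by
  obtain ⟨k, hk⟩ : ∃ k : ℕ, ‖(p : K)‖ ^ k * ‖f‖ < 1 := by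
    obtain ⟨k, hk⟩ := exists_pow_lt_of_lt_one (show 0 < (‖f‖ + 1)⁻¹ by positivity)
      (norm_natCast_prime_lt_one p (K := K))
    refine ⟨k, ?_⟩
    rw [← one_div, lt_div_iff₀ (by positivity)] at hk
    nlinarith [pow_nonneg (norm_nonneg (p : K)) k, norm_nonneg f]
  refine ⟨k, fun t => ?_⟩
  have h1 : (((p : TateAlgebra K n) ^ k * f : TateAlgebra K n) : MvPowerSeries (Fin n) K) =
      MvPowerSeries.C ((p : K) ^ k) * (f : MvPowerSeries (Fin n) K) := by simp
  rw [h1, MvPowerSeries.coeff_C_mul, norm_mul, norm_pow]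
  exact (mul_le_mul_of_nonneg_left (coeff_norm_le_norm f t) (by positivity)).trans hk.le

/-- An affinoid domain has a homomorphism to `PadicAlgCl p` which is nonzero at countably many
given nonzero elements. -/
theorem exists_algHom_padicAlgCl_ne_zero_of_surjective [FiniteDimensional ℚ_[p] K]
    {O : Type*} [CommRing O] [IsDomain O]
    [Algebra ℤ_[p] O] [Algebra K O] [IsScalarTower ℤ_[p] K O] (π : TateAlgebra K n →ₐ[K] O)
    (hπ : Function.Surjective π) (S : Set O) (hS : S.Countable) (hS0 : ∀ s ∈ S, s ≠ 0) :
    ∃ l : O →ₐ[ℤ_[p]] PadicAlgCl p, ∀ s ∈ S, l s ≠ 0 := by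
  have : CompleteSpace K := FiniteDimensional.complete ℚ_[p] K
  have : ProperSpace K := FiniteDimensional.proper ℚ_[p] K
  let T := unitBall p K n
  let ψ : T →ₐ[ℤ_[p]] O := (π.restrictScalars ℤ_[p]).comp T.val
  -- `A` is an integral model of `O`: it has no `p`-torsion because `p` is a unit of `O`, and `O =
  -- A[1/p]`.
  let A := ψ.range
  let ψA : T →ₐ[ℤ_[p]] A := ψ.rangeRestrict
  have hψA : Function.Surjective ψA := ψ.rangeRestrict_surjective
  have hpO : IsUnit (p : O) := by
    rw [← map_natCast (algebraMap K O)]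
    exact (IsUnit.mk0 _ (norm_pos_iff.mp (norm_natCast_prime_pos p))).map _
  have hreg : ∀ a : A, (p : A) * a = 0 → a = 0 := by
    intro a ha
    have h1 : (p : O) * (a : O) = 0 := congrArg Subtype.val ha
    exact Subtype.ext ((mul_eq_zero.mp h1).resolve_left hpO.ne_zero)
  have hTft := unitBall_finiteType p K n
  have hTnoeth : IsNoetherianRing (T ⧸ Ideal.span {(p : T)}) :=
    Algebra.FiniteType.isNoetherianRing ℤ_[p] (T ⧸ Ideal.span {(p : T)})
  have hTac := unitBall_isAdicComplete p K n
  have hAac : IsAdicComplete (Ideal.span {algebraMap ℤ_[p] A p}) A := by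
    let _ : Algebra T A := ψA.toRingHom.toAlgebra
    have h1 : algebraMap T A p = p := map_natCast ψA p
    have h2 := IsAdicComplete.of_surjective_of_torsionFree (T := T) (A := A) hψA (p : T)
      (by rwa [h1])
    rw [h1] at h2
    rwa [map_natCast]
  have hAft : Algebra.FiniteType ℤ_[p] (A ⧸ Ideal.span {algebraMap ℤ_[p] A p}) := by
    let q : T ⧸ Ideal.span {(p : T)} →ₐ[ℤ_[p]] A ⧸ Ideal.span {algebraMap ℤ_[p] A p} :=
      Ideal.quotientMapₐ _ ψA (by
        rw [Ideal.span_singleton_le_iff_mem, Ideal.mem_comap, map_natCast, map_natCast]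
        exact Ideal.mem_span_singleton_self _)
    refine Algebra.FiniteType.of_surjective q ?_
    intro z
    obtain ⟨a, rfl⟩ := Ideal.Quotient.mk_surjective z
    obtain ⟨t, rfl⟩ := hψA a
    exact ⟨Ideal.Quotient.mk _ t, rfl⟩
  obtain ⟨m, Φ, hΦ, hΦfin⟩ := exists_finite_injective_adicCompletion_mvPolynomial p (A := A)
    (by rwa [map_natCast])
  obtain ⟨ι, hι⟩ := exists_injective_adicCompletion_mvPolynomial p m
  have hmem : ∀ x : O, ∃ k, ∃ a : A, (p : O) ^ k * x = a := by
    intro x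
    obtain ⟨f, rfl⟩ := hπ x
    obtain ⟨k, hk⟩ := exists_pow_mul_mem_unitBall p f
    refine ⟨k, ⟨_, ⟨⟨_, hk⟩, rfl⟩⟩, ?_⟩
    change _ = π ((p : TateAlgebra K n) ^ k * f)
    simp
  choose k a hka using hmem
  -- Each `s` is replaced by its nonzero multiple `a s = p ^ k s` in `A`; nonvanishing there gives
  -- nonvanishing at `s`.
  obtain ⟨lA, hlA⟩ : ∃ l : A →ₐ[ℤ_[p]] PadicAlgCl p, ∀ s ∈ a '' S, l s ≠ 0 := by
    let B := AdicCompletion (Ideal.span {algebraMap ℤ_[p] (MvPolynomial (Fin m) ℤ_[p]) p})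
      (MvPolynomial (Fin m) ℤ_[p])
    let _ : Algebra B A := Φ.toRingHom.toAlgebra
    have h1 : Module.Finite B A := hΦfin
    have h2 := (faithfulSMul_iff_algebraMap_injective
      B A).mpr hΦ
    have h3 : IsScalarTower ℤ_[p] B A :=
      IsScalarTower.of_algebraMap_eq fun c => (Φ.commutes c).symm
    refine exists_algHom_padicAlgCl_ne_zero p ι hι (a '' S) (hS.image _) ?_
    rintro _ ⟨s, hs, rfl⟩ h0
    have h4 := hka s
    rw [h0] at h4
    exact mul_ne_zero (pow_ne_zero _ hpO.ne_zero) (hS0 s hs) h4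
  have hloc : IsLocalization.Away (p : A) O := by
    refine IsLocalization.Away.mk _ ?_ ?_ ?_
    · simpa using hpO
    · intro x
      refine ⟨k x, a x, ?_⟩
      rw [map_natCast, mul_comm]
      exact hka x
    · intro x y hxy
      exact ⟨0, by rw [Subtype.ext hxy]⟩
  have hunit : IsUnit (lA.toRingHom (p : A)) := by
    rw [map_natCast]
    exact (norm_pos_iff.mp (norm_natCast_prime_pos p)).isUnit
  let g : O →+* PadicAlgCl p := IsLocalization.Away.lift (p : A) hunit
  have hg : ∀ x : A, g x = lA x := fun x => IsLocalization.Away.lift_eq (p : A) hunit x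
  refine ⟨{ g with commutes' := fun c => ?_ }, fun s hs h0 => ?_⟩
  · exact (hg (algebraMap ℤ_[p] A c)).trans (lA.commutes c)
  · have h0' : g s = 0 := h0
    refine hlA (a s) ⟨s, hs, rfl⟩ ?_
    rw [← hg, ← hka, map_mul, h0', mul_zero]

end TateDefs

theorem proposition3 (p : ℕ) [Fact p.Prime]
    -- `K` is a `p`-adic number field, i.e. a finite extension of `ℚ_[p]`, with its absolute value
    (K : Type*) [NormedField K] [NormedAlgebra ℚ_[p] K] [FiniteDimensional ℚ_[p] K]
    [IsUltrametricDist K] [Algebra ℤ_[p] K] [IsScalarTower ℤ_[p] ℚ_[p] K]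
    (O : Type*) [CommRing O] [IsDomain O] [Algebra ℤ_[p] O]
    (S : Set O) (hS : S.Countable) (hS0 : ∀ s ∈ S, s ≠ 0) :
    -- `O` is finite over a power series ring over the ring of integers of `K`
    (∀ (m : ℕ) (φ : MvPowerSeries (Fin m) (integralClosure ℤ_[p] K) →ₐ[ℤ_[p]] O),
      Function.Injective φ → φ.Finite →
      ∃ (_ : IsLocalRing O) (l : O →ₐ[ℤ_[p]] PadicAlgCl p),
        @Continuous O (PadicAlgCl p) (IsLocalRing.maximalIdeal O).adicTopology _ l ∧
        ∀ s ∈ S, l s ≠ 0) ∧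
    -- `O` is an affinoid algebra over `K`
    (∀ [Algebra K O] [IsScalarTower ℤ_[p] K O], TateDefs.IsAffinoidAlgebra K O →
      ∃ l : O →ₐ[ℤ_[p]] PadicAlgCl p,
        (∀ (n : ℕ) (π : TateDefs.TateAlgebra K n →ₐ[K] O), Function.Surjective π →
          @Continuous O (PadicAlgCl p) (TateDefs.residueTopology π) _ l) ∧
        ∀ s ∈ S, l s ≠ 0) := by
  constructor
  · intro m φ hinj hfin
    have hOK : Module.Finite ℤ_[p] (integralClosure ℤ_[p] K) :=
      IsIntegralClosure.finite ℤ_[p] ℚ_[p] K _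
    have hOKinj : Function.Injective (algebraMap ℤ_[p] (integralClosure ℤ_[p] K)) := by
      intro x y hxy
      have h1 : algebraMap ℤ_[p] K x = algebraMap ℤ_[p] K y := congrArg Subtype.val hxy
      rw [IsScalarTower.algebraMap_apply ℤ_[p] ℚ_[p] K, IsScalarTower.algebraMap_apply ℤ_[p] ℚ_[p] K]
        at h1
      exact IsFractionRing.injective ℤ_[p] ℚ_[p] ((algebraMap ℚ_[p] K).injective h1)
    let μ : MvPowerSeries (Fin m) ℤ_[p] →ₐ[ℤ_[p]]
        MvPowerSeries (Fin m) (integralClosure ℤ_[p] K) :=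
      MvPowerSeries.mapAlgHom (Algebra.ofId ℤ_[p] (integralClosure ℤ_[p] K))
    refine exists_continuous_algHom_of_finite_mvPowerSeries p (φ.comp μ) ?_ ?_ S hS hS0
    · refine hinj.comp fun f g hfg => MvPowerSeries.ext fun t => hOKinj ?_
      exact congrArg (MvPowerSeries.coeff t) hfg
    · exact RingHom.Finite.comp hfin MvPowerSeries.map_finite
  · intro _ _ hO
    obtain ⟨n, π, hπ⟩ := hO
    obtain ⟨l, hl⟩ := TateDefs.exists_algHom_padicAlgCl_ne_zero_of_surjective p π hπ S hS hS0
    refine ⟨l, fun n' π' _ => ?_, hl⟩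
    -- For a coinduced topology only the composite with `π'` matters, and every homomorphism from a
    -- Tate algebra is continuous; so one `l` serves all presentations.
    rw [continuous_coinduced_dom]
    exact TateDefs.continuous_algHom_padicAlgCl p (l.comp (π'.restrictScalars ℤ_[p]))
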